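/- **Setting.** Let $W$ be a closed connected oriented surface of positive genus, with a base point $w$, fundamental group $\pi=\pi_1(W,w)$, Euler characteristic $\chi(W)$ and fundamental class $[W]\in H_2(W;\mathbb{Z})=H_2(\pi;\mathbb{Z})$. (Every closed surface can be triangulated. We take $W$ with a finite oriented triangulation, i.e. a homeomorphism from the geometric realization of a finite connected oriented simplicial complex, with every vertex in a triangle, every edge in exactly two triangles, which induce opposite orientations on it, and the link of every vertex a polygon. Then $\chi(W)$ is the number of vertices minus edges plus triangles, and $[W]$ is represented in the bar complex of $\pi$ by the sum of the oriented triangles, whose edges are made into loops by fixed paths from $w$ to the vertices.) Let $\pi$ act on the left by automorphisms on a finite group $\Phi$. *Non-abelian cohomology.* $Z^1(\pi;\Phi)$ is the set of maps $\alpha:\pi\to\Phi$ with $\alpha(ab)=\alpha(a)\,a(\alpha(b))$ for all $a,b\in\pi$; the group $\Phi$ acts on it by $(\varphi\alpha)(a)=\varphi\,\alpha(a)\,(a\varphi)^{-1}$; $H^1(\pi;\Phi)$ is the set of orbits; and for $h\in H^1(\pi;\Phi)$, $\mathrm{Aut}(h)\subset\Phi$ is the stabilizer of a cocycle representing $h$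 (well defined up to conjugation). Put $$\mathcal M(\pi;\Phi)=\sum_{h\in H^1(\pi;\Phi)}\frac1{|\mathrm{Aut}(h)|}\in\mathbb{Q}.$$ *Representations.* $\mathrm{Irr}(\Phi)$ is the set of equivalence classes of irreducible representations $\rho:\Phi\to GL_n(\mathbb{C})$, $n\ge 1$. For such $\rho$, let $\pi_\rho\subset\pi$ be the subgroup of all $a\in\pi$ such that the representation $\varphi\mapsto\rho(a^{-1}\varphi)$ is equivalent to $\rho$, i.e. such that there is $M_a\in GL_n(\mathbb{C})$ with $\rho(a^{-1}\varphi)=M_a^{-1}\rho(\varphi)M_a$ for all $\varphi\in\Phi$. Fix such an $M_a$ for every $a\in\pi_\rho$. The numbers $\zeta_{a,b}\in\mathbb{C}^*$ with $\zeta_{a,b}M_aM_b=M_{ab}$ for $a,b\in\pi_\rho$ form a 2-cocycle, whose class $\zeta_\rho\in H^2(\pi_\rho;\mathbb{C}^*)$ does not depend on the choice of the $M_a$. If $\pi_\rho=\pi$, let $\zeta_\rho([W])\in\mathbb{C}^*$ be the value of $\zeta_\rho$ on $[W]$. **Theorem.** The sets $H^1(\pi;\Phi)$ and $\mathrm{Irr}(\Phi)$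 are finite, and $$\mathcal M(\pi;\Phi)=\sum_{\rho\in\mathrm{Irr}(\Phi),\ \pi_\rho=\pi}\left(\frac{|\Phi|}{\dim\rho}\right)^{-\chi(W)}\zeta_\rho([W]).$$ -/

import Mathlib

open CategoryTheory

/-! ### Closed connected oriented (triangulated) surfaces -/

/-- A finite connected simplicial complex on the vertices `0, …, n - 1`, all of whose maximal
simplices are triangles, which is a closed surface, together with an orientation.
It is given by the set `tri` of the ordered triples `(x, y, z)` of vertices that span a triangle
and list its vertices in the positive cyclic order. -/
structure OrientedSurfaceComplex (n : ℕ) where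
  /-- the positively ordered triangles -/
  tri : Finset (Fin n × Fin n × Fin n)
  /-- a cyclic permutation of the vertices does not change the orientation -/
  rotate : ∀ x y z, (x, y, z) ∈ tri → (y, z, x) ∈ tri
  /-- the vertices of a triangle are distinct -/
  distinct : ∀ x y z, (x, y, z) ∈ tri → x ≠ y
  /-- a triangle has only one positive orientation -/
  oriented : ∀ x y z, (x, y, z) ∈ tri → (y, x, z) ∉ tri
  /-- every edge of a triangle is an edge of exactly one other triangle, and the two triangles
  induce opposite orientations on their common edge -/
  adjacent : ∀ x y z, (x, y, z) ∈ tri → ∃! w, (y, x, w) ∈ tri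
  /-- every vertex lies in a triangle -/
  cover : ∀ x, ∃ y z, (x, y, z) ∈ tri
  /-- the link of every vertex is connected (so that it is one polygon) -/
  link : ∀ x y z y' z', (x, y, z) ∈ tri → (x, y', z') ∈ tri →
    Relation.ReflTransGen (fun a b => (x, a, b) ∈ tri) y y'
  /-- any two vertices are joined by a chain of edges -/
  connected : ∀ x y, Relation.ReflTransGen (fun a b => ∃ c, (a, b, c) ∈ tri) x y
  /-- the surface is not empty -/
  nonempty : tri.Nonempty

namespace OrientedSurfaceComplex

variable {n : ℕ} (K : OrientedSurfaceComplex n)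

/-- The closed simplex spanned by the entries of a triple of vertices, in barycentric
coordinates. -/
def cell (t : Fin n × Fin n × Fin n) : Set (Fin n → ℝ) :=
  {p | p ∈ stdSimplex ℝ (Fin n) ∧ ∀ v, p v ≠ 0 → v = t.1 ∨ v = t.2.1 ∨ v = t.2.2}

/-- The geometric realization: the union of the closed triangles, with the topology of a subspace
of `ℝⁿ`. -/
def realization : Set (Fin n → ℝ) := ⋃ t ∈ K.tri, cell t

/-- The number of edges (pairs `x < y` of adjacent vertices). -/
def edgeCount : ℕ :=
  (Finset.univ.filter fun e : Fin n × Fin n => e.1 < e.2 ∧ ∃ z, (e.1, e.2, z) ∈ K.tri).card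

/-- The number of (unordered) triangles. -/
def triangleCount : ℕ :=
  (Finset.univ.filter fun t : Fin n × Fin n × Fin n =>
    t.1 < t.2.1 ∧ t.2.1 < t.2.2 ∧ (t ∈ K.tri ∨ (t.2.1, t.1, t.2.2) ∈ K.tri)).card

/-- The Euler characteristic. -/
def eulerChar : ℤ := n - K.edgeCount + K.triangleCount

/-- The genus `d`, determined by `χ = 2 - 2 d`. -/
def genus : ℤ := (2 - K.eulerChar) / 2

/-- `1` if `(x, y, z)` is a positively ordered triangle, `-1` if it is a negatively ordered
triangle, and `0` if it is not a triangle. -/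
def sign (x y z : Fin n) : ℤ :=
  if (x, y, z) ∈ K.tri then 1 else if (y, x, z) ∈ K.tri then -1 else 0

lemma rotate_iff (x y z : Fin n) : (x, y, z) ∈ K.tri ↔ (y, z, x) ∈ K.tri :=
  ⟨K.rotate _ _ _, fun h => K.rotate _ _ _ (K.rotate _ _ _ h)⟩

lemma sign_rotate (x y z : Fin n) : K.sign y z x = K.sign x y z := by
  unfold sign
  simp only [← K.rotate_iff x y z, ← K.rotate_iff x z y, K.rotate_iff y x z]

lemma sign_swap (x y z : Fin n) : K.sign y x z = - K.sign x y z := by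
  unfold sign
  have := K.oriented x y z
  have := K.oriented y x z
  split_ifs <;> simp_all

lemma sign_left (x y : Fin n) : K.sign x y x = 0 := by
  have := K.sign_rotate x y x
  have := K.sign_swap y x x
  have := K.sign_rotate y x x
  omega

lemma sign_right (x y : Fin n) : K.sign x y y = 0 := by
  have := K.sign_left y x
  have := K.sign_swap y x y
  omega

lemma sum_sign (x y : Fin n) : ∑ z, K.sign x y z = 0 := by
  have key : ∀ x y z, (x, y, z) ∈ K.tri → ∑ w, K.sign x y w = 0 := by
    intro x y z h
    obtain ⟨w, hw, huniq⟩ := K.adjacent x y z h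
    obtain ⟨z', hz', huniq'⟩ := K.adjacent y x w hw
    have hz : z = z' := huniq' z h
    have hzw : z ≠ w := by
      rintro rfl
      exact K.oriented _ _ _ h hw
    rw [Finset.sum_eq_add_of_mem z w (Finset.mem_univ _) (Finset.mem_univ _) hzw]
    · have h1 : K.sign x y z = 1 := if_pos h
      have h2 : K.sign y x w = 1 := if_pos hw
      have := K.sign_swap x y w
      omega
    · rintro v - ⟨hvz, hvw⟩
      unfold sign
      rw [if_neg, if_neg]
      · exact fun h' => hvw (huniq v h')
      · exact fun h' => hvz ((huniq' v h').trans hz.symm)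
  by_cases h : ∃ z, (x, y, z) ∈ K.tri
  · obtain ⟨z, hz⟩ := h
    exact key x y z hz
  · by_cases h' : ∃ z, (y, x, z) ∈ K.tri
    · obtain ⟨z, hz⟩ := h'
      have := key y x z hz
      simp only [K.sign_swap x y, Finset.sum_neg_distrib] at this
      omega
    · push Not at h h'
      exact Finset.sum_eq_zero fun z _ => by simp [sign, h, h']

lemma cell_subset {t : Fin n × Fin n × Fin n} (ht : t ∈ K.tri) : cell t ⊆ K.realization :=
  fun _ hp => Set.mem_biUnion ht hp

lemma convex_cell (t : Fin n × Fin n × Fin n) : Convex ℝ (cell t) := by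
  intro p hp q hq a b ha hb hab
  refine ⟨convex_stdSimplex ℝ _ hp.1 hq.1 ha hb hab, fun v hv => ?_⟩
  by_cases h : p v = 0
  · by_cases h' : q v = 0
    · simp [h, h'] at hv
    · exact hq.2 v h'
  · exact hp.2 v h

/-- The straight path between two points of one closed triangle. -/
def straightPath {t : Fin n × Fin n × Fin n} (p q : cell t) : Path p q where
  toFun s := ⟨(1 - (s : ℝ)) • (p : Fin n → ℝ) + (s : ℝ) • (q : Fin n → ℝ),
    convex_cell t p.2 q.2 (by linarith [s.2.2]) s.2.1 (by ring)⟩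
  continuous_toFun := by fun_prop
  source' := by simp
  target' := by simp

lemma straightPath_trans {t : Fin n × Fin n × Fin n} (p q r : cell t) :
    ((straightPath p q).trans (straightPath q r)).Homotopic (straightPath p r) := by
  have : ContractibleSpace (cell t) := (convex_cell t).contractibleSpace ⟨p, p.2⟩
  exact SimplyConnectedSpace.paths_homotopic _ _

lemma vertex_mem_cell {t : Fin n × Fin n × Fin n} {v : Fin n}
    (hv : v = t.1 ∨ v = t.2.1 ∨ v = t.2.2) : (Pi.single v 1 : Fin n → ℝ) ∈ cell t := by
  refine ⟨single_mem_stdSimplex ℝ v, fun u hu => ?_⟩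
  by_cases h : u = v
  · exact h ▸ hv
  · simp [h] at hu

lemma vertex_mem (v : Fin n) : (Pi.single v 1 : Fin n → ℝ) ∈ K.realization := by
  obtain ⟨y, z, h⟩ := K.cover v
  exact K.cell_subset h (vertex_mem_cell (Or.inl rfl))

/-- A vertex as a point of the realization. -/
def vertex (v : Fin n) : K.realization := ⟨Pi.single v 1, K.vertex_mem v⟩

/-- Two vertices are equal or adjacent. -/
def Near (x y : Fin n) : Prop :=
  ∃ t ∈ K.tri, (x = t.1 ∨ x = t.2.1 ∨ x = t.2.2) ∧ (y = t.1 ∨ y = t.2.1 ∨ y = t.2.2)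

/-- The straight path in the realization between two vertices of one triangle. -/
def edgePath {x y : Fin n} (h : K.Near x y) : Path (K.vertex x) (K.vertex y) where
  toFun s := ⟨(1 - (s : ℝ)) • (Pi.single x 1 : Fin n → ℝ) + (s : ℝ) • Pi.single y 1, by
    obtain ⟨t, ht, hx, hy⟩ := h
    exact K.cell_subset ht (convex_cell t (vertex_mem_cell hx) (vertex_mem_cell hy)
      (by linarith [s.2.2]) s.2.1 (by ring))⟩
  continuous_toFun := by fun_prop
  source' := by simp [vertex]
  target' := by simp [vertex]

lemma edgePath_trans {x y z : Fin n} {t : Fin n × Fin n × Fin n} (ht : t ∈ K.tri)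
    (hx : x = t.1 ∨ x = t.2.1 ∨ x = t.2.2) (hy : y = t.1 ∨ y = t.2.1 ∨ y = t.2.2)
    (hz : z = t.1 ∨ z = t.2.1 ∨ z = t.2.2) :
    ((K.edgePath ⟨t, ht, hx, hy⟩).trans (K.edgePath ⟨t, ht, hy, hz⟩)).Homotopic
      (K.edgePath ⟨t, ht, hx, hz⟩) := by
  have h := (straightPath_trans ⟨_, vertex_mem_cell hx⟩ ⟨_, vertex_mem_cell hy⟩
    ⟨_, vertex_mem_cell hz⟩).map ⟨Set.inclusion (K.cell_subset ht), by fun_prop⟩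
  rw [Path.map_trans] at h
  exact h

instance : PathConnectedSpace K.realization where
  nonempty := by
    obtain ⟨t, -⟩ := K.nonempty
    exact ⟨K.vertex t.1⟩
  joined := by
    have hv : ∀ p : K.realization, ∃ v, Joined p (K.vertex v) := by
      rintro ⟨p, hp⟩
      obtain ⟨t, ht, hpt⟩ := Set.mem_iUnion₂.1 hp
      exact ⟨t.1, ⟨(straightPath ⟨p, hpt⟩ ⟨_, vertex_mem_cell (Or.inl rfl)⟩).map
        (f := Set.inclusion (K.cell_subset ht)) (by fun_prop)⟩⟩
    have he : ∀ x y, Joined (K.vertex x) (K.vertex y) := by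
      intro x y
      induction K.connected x y with
      | refl => exact Joined.refl _
      | tail _ h ih =>
        obtain ⟨c, hc⟩ := h
        exact ih.trans ⟨K.edgePath ⟨_, hc, Or.inl rfl, Or.inr (Or.inl rfl)⟩⟩
    intro p q
    obtain ⟨x, hx⟩ := hv p
    obtain ⟨y, hy⟩ := hv q
    exact (hx.trans (he x y)).trans hy.symm

end OrientedSurfaceComplex

/-- A closed connected oriented surface: a topological space with an oriented triangulation by a
finite simplicial complex that is a closed surface. -/
structure ClosedOrientedSurface (W : Type) [TopologicalSpace W] where
  /-- the number of vertices -/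
  n : ℕ
  /-- the oriented simplicial complex -/
  complex : OrientedSurfaceComplex n
  /-- the triangulation -/
  homeo : complex.realization ≃ₜ W

/-! ### Second (co)homology of groups, and the fundamental class -/

/-- The second cohomology `H²(G; ℂˣ)` of a group with coefficients in the trivial module `ℂˣ`
(written additively). -/
abbrev H2Cx (G : Type) [Group G] : Type :=
  groupCohomology.H2 (Rep.trivial ℤ G (Additive ℂˣ))

/-- The second homology `H₂(G; ℤ)` of a group. -/
abbrev H2Z (G : Type) [Group G] : Type :=
  groupHomology.H2 (Rep.trivial ℤ G ℤ)

/-- The homomorphism `g^* : H²(H; ℂˣ) → H²(G; ℂˣ)` induced by a group homomorphism `g : G → H`. -/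
noncomputable def H2Cx.pullback {G H : Type} [Group G] [Group H] (g : G →* H) (ζ : H2Cx H) :
    H2Cx G :=
  groupCohomology.map (A := Rep.trivial ℤ H (Additive ℂˣ)) (B := Rep.trivial ℤ G (Additive ℂˣ)) g
    (Rep.ofHom ⟨LinearMap.id, fun _ => rfl⟩) 2 ζ

/-- The value of a 2-cochain with values in `ℂˣ` on an integral 2-chain. -/
noncomputable def chainPairing {G : Type} (f : G × G → Additive ℂˣ) (c : G × G →₀ ℤ) :
    Additive ℂˣ :=
  Finsupp.linearCombination ℤ f c

lemma chainPairing_coboundary {G : Type} [Group G] (f : G × G → Additive ℂˣ) (c : G × G →₀ ℤ)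
    (hf : f ∈ groupCohomology.coboundaries₂ (Rep.trivial ℤ G (Additive ℂˣ)))
    (hc : c ∈ groupHomology.cycles₂ (Rep.trivial ℤ G ℤ)) : chainPairing f c = 0 := by
  obtain ⟨x, rfl⟩ := hf
  have key : ∀ c : G × G →₀ ℤ,
      chainPairing ((groupCohomology.d₁₂ (Rep.trivial ℤ G (Additive ℂˣ))).hom x) c =
        Finsupp.linearCombination ℤ x ((groupHomology.d₂₁ (Rep.trivial ℤ G ℤ)).hom c) := by
    intro c
    induction c using Finsupp.induction_linear with
    | zero => simp [chainPairing]
    | add c d hc hd =>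
      simp only [chainPairing, map_add] at hc hd ⊢
      rw [hc, hd]
    | single g a =>
      have h : (groupHomology.d₂₁ (Rep.trivial ℤ G ℤ)).hom (Finsupp.single g a) =
          Finsupp.single g.2 a - Finsupp.single (g.1 * g.2) a + Finsupp.single g.1 a :=
        groupHomology.d₂₁_single (A := Rep.trivial ℤ G ℤ) g a
      rw [h, chainPairing, Finsupp.linearCombination_single, map_add, map_sub]
      simp only [Finsupp.linearCombination_single]
      rw [← smul_sub, ← smul_add]
      rfl
  rw [key]
  have : (groupHomology.d₂₁ (Rep.trivial ℤ G ℤ)).hom c = 0 := hc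
  rw [this, map_zero]

lemma chainPairing_boundary {G : Type} [Group G] (f : G × G → Additive ℂˣ) (c : G × G →₀ ℤ)
    (hf : f ∈ groupCohomology.cocycles₂ (Rep.trivial ℤ G (Additive ℂˣ)))
    (hc : c ∈ groupHomology.boundaries₂ (Rep.trivial ℤ G ℤ)) : chainPairing f c = 0 := by
  obtain ⟨x, rfl⟩ := hc
  have key : ∀ x : G × G × G →₀ ℤ,
      chainPairing f ((groupHomology.d₃₂ (Rep.trivial ℤ G ℤ)).hom x) =
        Finsupp.linearCombination ℤ
          ((groupCohomology.d₂₃ (Rep.trivial ℤ G (Additive ℂˣ))).hom f) x := by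
    intro c
    induction c using Finsupp.induction_linear with
    | zero => simp [chainPairing]
    | add c d hc hd =>
      simp only [chainPairing, map_add] at hc hd ⊢
      rw [hc, hd]
    | single g a =>
      have h : (groupHomology.d₃₂ (Rep.trivial ℤ G ℤ)).hom (Finsupp.single g a) =
          Finsupp.single (g.2.1, g.2.2) a - Finsupp.single (g.1 * g.2.1, g.2.2) a +
            Finsupp.single (g.1, g.2.1 * g.2.2) a - Finsupp.single (g.1, g.2.1) a :=
        groupHomology.d₃₂_single (A := Rep.trivial ℤ G ℤ) g a
      rw [h, chainPairing, Finsupp.linearCombination_single, map_sub, map_add, map_sub]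
      simp only [Finsupp.linearCombination_single]
      rw [← smul_sub, ← smul_add, ← smul_sub]
      rfl
  rw [key]
  have : (groupCohomology.d₂₃ (Rep.trivial ℤ G (Additive ℂˣ))).hom f = 0 := hf
  rw [this]
  exact Finsupp.linearCombination_zero_apply (R := ℤ) x

lemma H2Cx.exists_cocycle {G : Type} [Group G] (ζ : H2Cx G) :
    ∃ f : groupCohomology.cocycles₂ (Rep.trivial ℤ G (Additive ℂˣ)),
      groupCohomology.H2π _ f = ζ := by
  induction ζ using groupCohomology.H2_induction_on with
  | h f => exact ⟨f, rfl⟩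

lemma H2Z.exists_cycle {G : Type} [Group G] (z : H2Z G) :
    ∃ c : groupHomology.cycles₂ (Rep.trivial ℤ G ℤ), groupHomology.H2π _ c = z := by
  induction z using groupHomology.H2_induction_on with
  | h c => exact ⟨c, rfl⟩

/-- The evaluation `ζ(z) ∈ ℂˣ` of `ζ ∈ H²(G; ℂˣ)` on `z ∈ H₂(G; ℤ)`: the value of any cocycle
representing `ζ` on any cycle representing `z`, see `H2Cx.eval_mk`. -/
noncomputable def H2Cx.eval {G : Type} [Group G] (ζ : H2Cx G) (z : H2Z G) : ℂˣ :=
  Additive.toMul (chainPairing ζ.exists_cocycle.choose.1 z.exists_cycle.choose.1)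

lemma H2Cx.eval_mk {G : Type} [Group G]
    (f : groupCohomology.cocycles₂ (Rep.trivial ℤ G (Additive ℂˣ)))
    (c : groupHomology.cycles₂ (Rep.trivial ℤ G ℤ)) :
    H2Cx.eval (groupCohomology.H2π _ f) (groupHomology.H2π _ c) =
      Additive.toMul (chainPairing f.1 c.1) := by
  let f' := (H2Cx.exists_cocycle (groupCohomology.H2π _ f)).choose
  let c' := (H2Z.exists_cycle (groupHomology.H2π _ c)).choose
  have hf : f'.1 - f.1 ∈ groupCohomology.coboundaries₂ (Rep.trivial ℤ G (Additive ℂˣ)) :=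
    (groupCohomology.H2π_eq_iff f' f).1 (H2Cx.exists_cocycle _).choose_spec
  have hc : c'.1 - c.1 ∈ groupHomology.boundaries₂ (Rep.trivial ℤ G ℤ) :=
    (groupHomology.H2π_eq_iff c' c).1 (H2Z.exists_cycle _).choose_spec
  have h1 := chainPairing_coboundary _ _ hf c'.2
  have h2 := chainPairing_boundary _ _ f.2 hc
  have h3 : chainPairing f'.1 c'.1 = chainPairing f.1 c'.1 := by
    rw [← sub_eq_zero, ← h1]
    simp [chainPairing, Finsupp.linearCombination_apply, Finsupp.sum, smul_sub]
  have h4 : chainPairing f.1 c'.1 = chainPairing f.1 c.1 := by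
    rw [← sub_eq_zero, ← h2, chainPairing, chainPairing, chainPairing, ← map_sub]
  exact congrArg Additive.toMul (h3.trans h4)

namespace ClosedOrientedSurface

variable {W : Type} [TopologicalSpace W] (S : ClosedOrientedSurface W)

/-- A vertex of the triangulation as a point of the surface. -/
def vertex (v : Fin S.n) : W := S.homeo (S.complex.vertex v)

/-- The Euler characteristic `χ(W)`. -/
def eulerChar : ℤ := S.complex.eulerChar

/-- The genus of the surface. -/
def genus : ℤ := S.complex.genus

/-- The path along an edge from the vertex `x` to the vertex `y`. -/
def edgePath {x y : Fin S.n} (h : S.complex.Near x y) : Path (S.vertex x) (S.vertex y) :=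
  (S.complex.edgePath h).map S.homeo.continuous

lemma pathConnected {W : Type} [TopologicalSpace W] (S : ClosedOrientedSurface W) :
    PathConnectedSpace W :=
  S.homeo.surjective.pathConnectedSpace S.homeo.continuous

/-- A choice of a path from the base point to every vertex. -/
noncomputable def basePath (w : W) (v : Fin S.n) : Path w (S.vertex v) :=
  (S.pathConnected.joined w (S.vertex v)).somePath

open Classical in
/-- For equal or adjacent vertices `x`, `y`, the class of the loop which goes from the base point
to `y`, along the edge to `x` and back to the base point (and `1` otherwise). A product `g * h` in
Mathlib's fundamental group is the class of a loop `h` followed by a loop `g`; thus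
`edgeLoop x y * edgeLoop y z = edgeLoop x z` for the vertices of a triangle. -/
noncomputable def edgeLoop (w : W) (x y : Fin S.n) : FundamentalGroup W w :=
  if h : S.complex.Near y x then
    FundamentalGroup.fromPath (Path.Homotopic.Quotient.mk
      (((S.basePath w y).trans (S.edgePath h)).trans (S.basePath w x).symm))
  else 1

lemma edgeLoop_mul (w : W) {x y z : Fin S.n} {t : Fin S.n × Fin S.n × Fin S.n}
    (ht : t ∈ S.complex.tri)
    (hx : x = t.1 ∨ x = t.2.1 ∨ x = t.2.2) (hy : y = t.1 ∨ y = t.2.1 ∨ y = t.2.2)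
    (hz : z = t.1 ∨ z = t.2.1 ∨ z = t.2.2) :
    S.edgeLoop w x y * S.edgeLoop w y z = S.edgeLoop w x z := by
  have h : Path.Homotopic.Quotient.trans (.mk (S.edgePath ⟨t, ht, hz, hy⟩))
      (.mk (S.edgePath ⟨t, ht, hy, hx⟩)) = .mk (S.edgePath ⟨t, ht, hz, hx⟩) := by
    rw [← Path.Homotopic.Quotient.mk_trans, Path.Homotopic.Quotient.eq]
    have h := (S.complex.edgePath_trans ht hz hy hx).map ⟨S.homeo, S.homeo.continuous⟩
    rw [Path.map_trans] at h
    exact h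
  rw [edgeLoop, edgeLoop, edgeLoop, dif_pos ⟨t, ht, hy, hx⟩, dif_pos ⟨t, ht, hz, hy⟩,
    dif_pos ⟨t, ht, hz, hx⟩]
  change Path.Homotopic.Quotient.trans _ _ = _
  simp only [FundamentalGroup.fromPath, Path.Homotopic.Quotient.mk_trans,
    Path.Homotopic.Quotient.mk_symm, ← h, Path.Homotopic.Quotient.trans_assoc]
  congr 2
  rw [← Path.Homotopic.Quotient.trans_assoc (.symm _), Path.Homotopic.Quotient.symm_trans,
    Path.Homotopic.Quotient.refl_trans]

/-- The sum of the triangles with vertices `x < y < z`, taken with the sign of their orientation,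
as an integral 2-chain `∑ ± [g_{xy} | g_{yz}]` of the fundamental group. -/
noncomputable def fundamentalChain (w : W) :
    FundamentalGroup W w × FundamentalGroup W w →₀ ℤ :=
  ∑ x, ∑ y, ∑ z, if x < y ∧ y < z then
    Finsupp.single (S.edgeLoop w x y, S.edgeLoop w y z) (S.complex.sign x y z) else 0

lemma fundamentalChain_mem (w : W) :
    S.fundamentalChain w ∈ groupHomology.cycles₂ (Rep.trivial ℤ (FundamentalGroup W w) ℤ) := by
  change (groupHomology.d₂₁ (Rep.trivial ℤ (FundamentalGroup W w) ℤ)).hom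
    (S.fundamentalChain w) = 0
  set g := S.edgeLoop w
  set s := S.complex.sign with hs
  let e : Fin S.n → Fin S.n → FundamentalGroup W w →₀ ℤ := fun x y => Finsupp.single (g x y) 1
  have hterm : ∀ x y z, (groupHomology.d₂₁ (Rep.trivial ℤ (FundamentalGroup W w) ℤ)).hom
      (if x < y ∧ y < z then Finsupp.single (g x y, g y z) (s x y z) else 0) =
      (if x < y ∧ y < z then s x y z else 0) • e y z -
        (if x < y ∧ y < z then s x y z else 0) • e x z +
        (if x < y ∧ y < z then s x y z else 0) • e x y := by
    intro x y z
    split_ifs with h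
    · have h1 : (groupHomology.d₂₁ (Rep.trivial ℤ (FundamentalGroup W w) ℤ)).hom
          (Finsupp.single (g x y, g y z) (s x y z)) =
          Finsupp.single (g y z) (s x y z) - Finsupp.single (g x y * g y z) (s x y z) +
            Finsupp.single (g x y) (s x y z) :=
        groupHomology.d₂₁_single (A := Rep.trivial ℤ (FundamentalGroup W w) ℤ) _ _
      rw [h1]
      by_cases h0 : s x y z = 0
      · simp [h0]
      · have hg : g x y * g y z = g x z := by
          have : (x, y, z) ∈ S.complex.tri ∨ (y, x, z) ∈ S.complex.tri := by
            by_contra! h'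
            exact h0 (by simp [hs, OrientedSurfaceComplex.sign, h'])
          rcases this with ht | ht <;> exact S.edgeLoop_mul w ht (by simp) (by simp) (by simp)
        rw [hg]
        simp [e]
    · simp
  rw [fundamentalChain]
  simp only [map_sum]
  refine (Finset.sum_congr rfl fun x _ => Finset.sum_congr rfl fun y _ =>
    Finset.sum_congr rfl fun z _ => hterm x y z).trans ?_
  simp only [Finset.sum_add_distrib, Finset.sum_sub_distrib]
  have A : ∑ x, ∑ y, ∑ z, (if x < y ∧ y < z then s x y z else 0) • e y z =
      ∑ u, ∑ v, ∑ z, (if z < u ∧ u < v then s z u v else 0) • e u v := by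
    rw [Finset.sum_comm]
    exact Finset.sum_congr rfl fun y _ => Finset.sum_comm
  have B : ∑ x, ∑ y, ∑ z, (if x < y ∧ y < z then s x y z else 0) • e x z =
      ∑ u, ∑ v, ∑ z, (if u < z ∧ z < v then s u z v else 0) • e u v :=
    Finset.sum_congr rfl fun y _ => Finset.sum_comm
  rw [A, B]
  simp only [← Finset.sum_sub_distrib, ← Finset.sum_add_distrib, ← sub_smul, ← add_smul]
  refine Finset.sum_eq_zero fun u _ => Finset.sum_eq_zero fun v _ => ?_
  rw [← Finset.sum_smul]
  have C : ∀ z, (if z < u ∧ u < v then s z u v else 0) - (if u < z ∧ z < v then s u z v else 0) +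
      (if u < v ∧ v < z then s u v z else 0) = if u < v then s u v z else 0 := by
    intro z
    have h1 : s z u v = s u v z := (S.complex.sign_rotate z u v).symm
    have h2 : s u z v = - s u v z := by
      change S.complex.sign u z v = - S.complex.sign u v z
      rw [← S.complex.sign_rotate u z v, S.complex.sign_swap v z u, S.complex.sign_rotate u v z]
    have h3 : z = u → s u v z = 0 := by
      rintro rfl
      exact S.complex.sign_left z v
    have h4 : z = v → s u v z = 0 := by
      rintro rfl
      exact S.complex.sign_right u z
    rw [h1, h2]
    clear_value s
    generalize s u v z = k at h3 h4
    clear h1 h2 hterm A B hs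
    grind
  simp only [C]
  split_ifs
  · rw [hs, S.complex.sum_sign, zero_smul]
  · simp

/-- The fundamental class `[W]`, as an element of `H₂(π₁(W); ℤ)`. -/
noncomputable def fundamentalClass (w : W) : H2Z (FundamentalGroup W w) :=
  groupHomology.H2π _ ⟨S.fundamentalChain w, S.fundamentalChain_mem w⟩

end ClosedOrientedSurface

/-! ### Irreducible representations -/

/-- An irreducible complex linear representation of dimension `n ≥ 1`. -/
structure IrrRep (Φ : Type*) [Group Φ] (n : ℕ) where
  /-- the homomorphism to the general linear group -/
  hom : Φ →* GL (Fin n) ℂ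
  /-- the dimension is positive -/
  pos : 0 < n
  /-- the only invariant subspaces are the obvious ones -/
  irreducible : ∀ V : Submodule ℂ (Fin n → ℂ),
    (∀ φ, ∀ v ∈ V, (hom φ : Matrix (Fin n) (Fin n) ℂ).mulVec v ∈ V) → V = ⊥ ∨ V = ⊤

namespace IrrRep

variable {Φ : Type*} [Group Φ] {n : ℕ}

/-- Equivalence of representations. -/
instance setoid (Φ : Type*) [Group Φ] (n : ℕ) : Setoid (IrrRep Φ n) where
  r ρ ρ' := ∃ M : GL (Fin n) ℂ, ∀ φ, ρ'.hom φ = M⁻¹ * ρ.hom φ * M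
  iseqv :=
    { refl := fun ρ => ⟨1, fun φ => by simp⟩
      symm := by
        rintro ρ ρ' ⟨M, hM⟩
        exact ⟨M⁻¹, fun φ => by rw [hM]; group⟩
      trans := by
        rintro ρ ρ' ρ'' ⟨M, hM⟩ ⟨N, hN⟩
        exact ⟨M * N, fun φ => by rw [hN, hM]; group⟩ }

lemma schur (ρ : IrrRep Φ n) (T : GL (Fin n) ℂ) (hT : ∀ φ, T * ρ.hom φ = ρ.hom φ * T) :
    ∃ c : ℂˣ, (T : Matrix (Fin n) (Fin n) ℂ) = (c : ℂ) • 1 := by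
  have : Nonempty (Fin n) := ⟨⟨0, ρ.pos⟩⟩
  obtain ⟨c, hc⟩ := Module.End.exists_eigenvalue (Matrix.toLin' (T : Matrix (Fin n) (Fin n) ℂ))
  have hmem : ∀ v, v ∈ Module.End.eigenspace (Matrix.toLin' (T : Matrix (Fin n) (Fin n) ℂ)) c ↔
      (T : Matrix (Fin n) (Fin n) ℂ).mulVec v = c • v := fun v => by
    rw [Module.End.mem_eigenspace_iff, Matrix.toLin'_apply]
  have htop : Module.End.eigenspace (Matrix.toLin' (T : Matrix (Fin n) (Fin n) ℂ)) c = ⊤ := by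
    refine (ρ.irreducible _ fun φ v hv => ?_).resolve_left hc
    rw [hmem] at hv ⊢
    have h : (T : Matrix (Fin n) (Fin n) ℂ) * (ρ.hom φ : Matrix (Fin n) (Fin n) ℂ) =
        (ρ.hom φ : Matrix (Fin n) (Fin n) ℂ) * T := congrArg Units.val (hT φ)
    rw [Matrix.mulVec_mulVec, h, ← Matrix.mulVec_mulVec, hv, Matrix.mulVec_smul]
  have hT' : (T : Matrix (Fin n) (Fin n) ℂ) = c • 1 := by
    refine Matrix.toLin'.injective (LinearMap.ext fun v => ?_)
    have hv : v ∈ Module.End.eigenspace (Matrix.toLin' (T : Matrix (Fin n) (Fin n) ℂ)) c :=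
      htop ▸ Submodule.mem_top
    rw [hmem] at hv
    simp [hv]
  have hc0 : c ≠ 0 := by
    rintro rfl
    have h := T.mul_inv
    rw [hT', zero_smul, zero_mul] at h
    exact zero_ne_one h
  exact ⟨Units.mk0 c hc0, hT'⟩

variable {π : Type} [Group π] [MulDistribMulAction π Φ]

variable (π) in
/-- The subgroup `π_ρ` of all `a ∈ π` such that the representation `φ ↦ ρ (a⁻¹ φ)` is equivalent
to `ρ`. -/
def stab (ρ : IrrRep Φ n) : Subgroup π where
  carrier := {a | ∃ M : GL (Fin n) ℂ, ∀ φ : Φ, ρ.hom (a⁻¹ • φ) = M⁻¹ * ρ.hom φ * M}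
  one_mem' := ⟨1, fun φ => by simp⟩
  mul_mem' := by
    rintro a b ⟨M, hM⟩ ⟨N, hN⟩
    exact ⟨M * N, fun φ => by rw [mul_inv_rev, mul_smul, hN, hM]; group⟩
  inv_mem' := by
    rintro a ⟨M, hM⟩
    refine ⟨M⁻¹, fun φ => ?_⟩
    have := hM (a • φ)
    rw [inv_smul_smul] at this
    rw [this, inv_inv]
    group

/-- A matrix `M_a` with `ρ (a⁻¹ φ) = M_a⁻¹ ρ(φ) M_a` for all `φ`; it is unique up to a
non-zero scalar. -/
noncomputable def conj (ρ : IrrRep Φ n) (a : ρ.stab π) : GL (Fin n) ℂ := a.2.choose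

lemma conj_spec (ρ : IrrRep Φ n) (a : ρ.stab π) (φ : Φ) :
    ρ.hom ((a : π)⁻¹ • φ) = (ρ.conj a)⁻¹ * ρ.hom φ * ρ.conj a := a.2.choose_spec φ

lemma exists_zeta (ρ : IrrRep Φ n) (a b : ρ.stab π) :
    ∃ ζ : ℂˣ, (ζ : ℂ) • ((ρ.conj a * ρ.conj b : GL (Fin n) ℂ) : Matrix (Fin n) (Fin n) ℂ) =
      ρ.conj (a * b) := by
  obtain ⟨c, hc⟩ := ρ.schur (ρ.conj (a * b) * (ρ.conj a * ρ.conj b)⁻¹) fun φ => by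
    have h1 := ρ.conj_spec (a * b) φ
    have h2 := ρ.conj_spec b ((a : π)⁻¹ • φ)
    rw [ρ.conj_spec a φ] at h2
    rw [Subgroup.coe_mul, mul_inv_rev, mul_smul, h2] at h1
    have h3 : ρ.hom φ = ρ.conj a * (ρ.conj b * ((ρ.conj (a * b))⁻¹ * ρ.hom φ *
        ρ.conj (a * b)) * (ρ.conj b)⁻¹) * (ρ.conj a)⁻¹ := by
      rw [← h1]
      group
    have h4 : ρ.conj (a * b) * (ρ.conj a * ρ.conj b)⁻¹ * ρ.hom φ =
        ρ.conj (a * b) * (ρ.conj a * ρ.conj b)⁻¹ * (ρ.conj a * (ρ.conj b * ((ρ.conj (a * b))⁻¹ *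
          ρ.hom φ * ρ.conj (a * b)) * (ρ.conj b)⁻¹) * (ρ.conj a)⁻¹) := congrArg _ h3
    rw [h4]
    group
  refine ⟨c, ?_⟩
  have h := congrArg (fun X : Matrix (Fin n) (Fin n) ℂ =>
    X * ((ρ.conj a * ρ.conj b : GL (Fin n) ℂ) : Matrix (Fin n) (Fin n) ℂ)) hc
  simp only [smul_mul_assoc, one_mul] at h
  rw [← h, ← Units.val_mul, inv_mul_cancel_right]

/-- The number `ζ_{a,b}` with `ζ_{a,b} M_a M_b = M_{ab}`. -/
noncomputable def zeta (ρ : IrrRep Φ n) (a b : ρ.stab π) : ℂˣ := (ρ.exists_zeta a b).choose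

lemma zeta_spec (ρ : IrrRep Φ n) (a b : ρ.stab π) :
    (ρ.zeta a b : ℂ) •
      ((ρ.conj a * ρ.conj b : GL (Fin n) ℂ) : Matrix (Fin n) (Fin n) ℂ) = ρ.conj (a * b) :=
  (ρ.exists_zeta a b).choose_spec

lemma zeta_mem (ρ : IrrRep Φ n) :
    (fun g : ρ.stab π × ρ.stab π => Additive.ofMul (ρ.zeta g.1 g.2)) ∈
      groupCohomology.cocycles₂ (Rep.trivial ℤ (ρ.stab π) (Additive ℂˣ)) := by
  rw [groupCohomology.mem_cocycles₂_iff]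
  intro a b c
  change Additive.ofMul (ρ.zeta (a * b) c) + Additive.ofMul (ρ.zeta a b) =
    Additive.ofMul (ρ.zeta b c) + Additive.ofMul (ρ.zeta a (b * c))
  rw [← ofMul_mul, ← ofMul_mul]
  refine congrArg Additive.ofMul (Units.ext ?_)
  have h1 := ρ.zeta_spec (a * b) c
  have h2 := ρ.zeta_spec a (b * c)
  rw [Units.val_mul, ← ρ.zeta_spec a b, smul_mul_assoc, smul_smul,
    ← Units.val_mul (ρ.conj a * ρ.conj b)] at h1
  rw [Units.val_mul, ← ρ.zeta_spec b c, mul_smul_comm, smul_smul,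
    ← Units.val_mul (ρ.conj a), ← mul_assoc (ρ.conj a), ← mul_assoc a b c, ← h1] at h2
  have h3 := congrArg (fun X : Matrix (Fin n) (Fin n) ℂ =>
    X * ((ρ.conj a * ρ.conj b * ρ.conj c : GL (Fin n) ℂ)⁻¹ : GL (Fin n) ℂ)) h2
  simp only [smul_mul_assoc, ← Units.val_mul, mul_inv_cancel] at h3
  have h4 := congrFun (congrFun h3 ⟨0, ρ.pos⟩) ⟨0, ρ.pos⟩
  simp only [Matrix.smul_apply, Units.val_one, Matrix.one_apply_eq, smul_eq_mul, mul_one] at h4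
  rw [← h4, Units.val_mul, Units.val_mul, mul_comm]

variable (π) in
/-- The cohomology class `ζ_ρ ∈ H²(π_ρ; ℂˣ)`. -/
noncomputable def zetaClass (ρ : IrrRep Φ n) : H2Cx (ρ.stab π) :=
  groupCohomology.H2π _ ⟨_, ρ.zeta_mem⟩

/-- The value `ζ_ρ(z)` for `z ∈ H₂(π; ℤ)` in the case `π_ρ = π`. -/
noncomputable def zetaEval (ρ : IrrRep Φ n) (hρ : ρ.stab π = ⊤) (z : H2Z π) : ℂˣ :=
  ((ρ.zetaClass π).pullback ((MonoidHom.id π).codRestrict (ρ.stab π) fun a => by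
    simp [hρ])).eval z

end IrrRep

/-- The set `Irr(Φ)` of equivalence classes of irreducible representations of `Φ`: pairs of a
dimension and an equivalence class of representations of that dimension. -/
abbrev Irr (Φ : Type*) [Group Φ] : Type _ := Σ n : ℕ, Quotient (IrrRep.setoid Φ n)

/-- The dimension of a class of representations. -/
def Irr.dim {Φ : Type*} [Group Φ] (c : Irr Φ) : ℕ := c.1

/-- A representative of a class of representations. -/
noncomputable def Irr.rep {Φ : Type*} [Group Φ] (c : Irr Φ) : IrrRep Φ c.dim := c.2.out

/-! ### Non-abelian cohomology -/

/-- The cocycles `α : π → Φ`, the elements of `Z¹(π; Φ)`. -/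
@[ext]
structure NonabCocycle (π Φ : Type*) [Group π] [Group Φ] [MulDistribMulAction π Φ] where
  /-- the underlying map -/
  toFun : π → Φ
  /-- the cocycle identity -/
  map_mul : ∀ a b, toFun (a * b) = toFun a * a • toFun b

/-- The action `(φ α)(a) = φ α(a) (a φ)⁻¹` of `Φ` on cocycles. -/
instance (π Φ : Type*) [Group π] [Group Φ] [MulDistribMulAction π Φ] :
    MulAction Φ (NonabCocycle π Φ) where
  smul φ α := ⟨fun a => φ * α.toFun a * (a • φ)⁻¹, fun a b => by
    simp only [α.map_mul, mul_smul, smul_mul', smul_inv']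
    group⟩
  one_smul α := NonabCocycle.ext <| funext fun a => by
    change 1 * α.toFun a * (a • (1 : Φ))⁻¹ = α.toFun a
    simp
  mul_smul φ ψ α := NonabCocycle.ext <| funext fun a => by
    change φ * ψ * α.toFun a * (a • (φ * ψ))⁻¹ =
      φ * (ψ * α.toFun a * (a • ψ)⁻¹) * (a • φ)⁻¹
    rw [smul_mul']
    group

/-- The non-abelian cohomology `H¹(π; Φ)`. -/
abbrev NonabH1 (π Φ : Type*) [Group π] [Group Φ] [MulDistribMulAction π Φ] : Type _ :=
  MulAction.orbitRel.Quotient Φ (NonabCocycle π Φ)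

/-- The group `Aut(h)`: the stabilizer of a cocycle representing `h` (well defined up to
conjugation). -/
noncomputable def NonabH1.aut {π Φ : Type*} [Group π] [Group Φ] [MulDistribMulAction π Φ]
    (h : NonabH1 π Φ) : Subgroup Φ :=
  MulAction.stabilizer Φ (Quotient.out h)

/-- The measure `M(π; Φ) = ∑_{h ∈ H¹(π; Φ)} 1 / |Aut(h)|`. -/
noncomputable def nonabMeasure (π Φ : Type*) [Group π] [Group Φ] [MulDistribMulAction π Φ] : ℚ :=
  ∑ᶠ h : NonabH1 π Φ, 1 / (Nat.card h.aut : ℚ)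

/-! The proof evaluates a lattice gauge theory sum on the triangulation, with `n` vertices, E edges
and F triangles.

From groups to simplices. By orbit-stabilizer, M(π;Φ) = |Z¹(π;Φ)| / |Φ| (`nonabMeasure_eq`). A
cocycle α and a gauge function f on the vertices give the simplicial cocycle c(x,y) = f(x) α(g_xy)
(g_xy f(y))⁻¹, and (α, f) ↦ (c, f(v)) is a bijection for any vertex v. Hence |Z¹| |Φ|^n equals |Φ|
times the number of twisted simplicial cocycles (`card_twistedCocycle`). Injectivity holds because
every path between vertices is homotopic to a chain of edges (`edgePath_induction`). Surjectivity
holds because a function on edges that is multiplicative on triangles is the monodromy of a covering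
(`IsFlat.exists_transport`); this is applied to the pairs (c(x,y), g_xy) in Φ ⋊ π.

Fourier expansion. A twisted cocycle is an arbitrary function from the E edges to Φ whose holonomy
around each of the F triangles is 1. Writing each condition as δ₁ = ∑ (dim ρ / |Φ|) χ_ρ
(`sum_dim_mul_char`) turns the count into a sum over labellings of the triangles by irreducible
representations. Multiplying the value at one edge by ψ and averaging over ψ changes only the two
adjacent triangles, so Schur orthogonality kills a labelling whose two labels differ there after
transport along the edge (`dartChar_flip_of_sum_ne_zero`). As the surface is connected, only
constant labellings by some ρ with π_ρ = π survive.

The surviving terms. For such ρ of dimension m, the matrices M_a turn each character into the trace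
of a product of three edge matrices, up to the scalar ζ of the triangle; these scalars multiply to
ζ_ρ([W]) (`zetaEval_fundamentalClass`, `triangleZeta_smul`). Schur orthogonality at each edge gives
a factor |Φ|/m and identifies matrix indices around vertices, leaving one free index per vertex,
hence m^n (`sum_prod_trace`). With the Fourier factor (m/|Φ|)^F and the gauge factor |Φ|^(-n) the
total is (|Φ|/m)^(E - n - F) ζ_ρ([W]), and E - n - F = -χ(W). -/

/-! ### Paths in triangulated surfaces -/

/-- Two paths with the same endpoints inside a simply connected subspace are homotopic. -/
lemma Path.Homotopic.of_forall_mem {X : Type*} [TopologicalSpace X] (A : Set X)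
    [SimplyConnectedSpace A] {x y : X} (γ γ' : Path x y) (h : ∀ s, γ s ∈ A) (h' : ∀ s, γ' s ∈ A) :
    γ.Homotopic γ' := by
  have hx : x ∈ A := by simpa using h 0
  have hy : y ∈ A := by simpa using h 1
  let δ : Path (⟨x, hx⟩ : A) ⟨y, hy⟩ :=
    ⟨⟨fun s => ⟨γ s, h s⟩, by fun_prop⟩, by simp, by simp⟩
  let δ' : Path (⟨x, hx⟩ : A) ⟨y, hy⟩ :=
    ⟨⟨fun s => ⟨γ' s, h' s⟩, by fun_prop⟩, by simp, by simp⟩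
  exact (SimplyConnectedSpace.paths_homotopic δ δ').map ⟨((↑) : A → X), by fun_prop⟩

namespace ClosedOrientedSurface

variable {W : Type} [TopologicalSpace W] (S : ClosedOrientedSurface W)

/-- The barycentric coordinates of a point of the surface. -/
def coord (p : W) : Fin S.n → ℝ := S.homeo.symm p

lemma continuous_coord : Continuous S.coord := by
  unfold coord
  fun_prop

@[simp]
lemma coord_homeo (p : S.complex.realization) : S.coord (S.homeo p) = p := by
  simp [coord]

lemma coord_vertex (v : Fin S.n) : S.coord (S.vertex v) = Pi.single v 1 := by
  simp [vertex, OrientedSurfaceComplex.vertex]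

/-- The preimage under the coordinates of a subset of the realization is homeomorphic to it. -/
def coordPreimage {B : Set (Fin S.n → ℝ)} (hB : B ⊆ S.complex.realization) :
    (S.coord ⁻¹' B : Set W) ≃ₜ B where
  toFun p := ⟨S.coord p, p.2⟩
  invFun b := ⟨S.homeo ⟨b, hB b.2⟩, by simp⟩
  left_inv p := by simp [coord]
  right_inv b := by simp
  continuous_toFun := by
    have := S.continuous_coord
    fun_prop
  continuous_invFun := by fun_prop

lemma simplyConnectedSpace_coordPreimage {B : Set (Fin S.n → ℝ)}
    (hB : B ⊆ S.complex.realization) {b : Fin S.n → ℝ} (hb : b ∈ B) (h : StarConvex ℝ b B) :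
    SimplyConnectedSpace (S.coord ⁻¹' B : Set W) := by
  have := h.contractibleSpace ⟨b, hb⟩
  exact (S.coordPreimage hB).toHomotopyEquiv.simplyConnectedSpace

/-- The open star of a vertex. -/
def star (v : Fin S.n) : Set W := {p | 0 < S.coord p v}

lemma isOpen_star (v : Fin S.n) : IsOpen (S.star v) := by
  have := S.continuous_coord
  exact isOpen_lt continuous_const (by fun_prop)

lemma coord_mem (p : W) : S.coord p ∈ S.complex.realization := (S.homeo.symm p).2

lemma exists_mem_cell (p : W) :
    ∃ t ∈ S.complex.tri, S.coord p ∈ OrientedSurfaceComplex.cell t := by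
  simpa [OrientedSurfaceComplex.realization] using S.coord_mem p

lemma exists_mem_star (p : W) : ∃ v, p ∈ S.star v := by
  obtain ⟨t, -, ht⟩ := S.exists_mem_cell p
  by_contra! h
  have h1 : ∑ v, S.coord p v ≤ 0 := Finset.sum_nonpos fun v _ => not_lt.1 (h v)
  rw [ht.1.2] at h1
  linarith

lemma vertex_mem_star {x v : Fin S.n} : S.vertex x ∈ S.star v ↔ v = x := by
  simp only [star, Set.mem_ofPred_eq, coord_vertex, Pi.single_apply]
  split_ifs with h <;> simp [h]

lemma star_eq (v : Fin S.n) :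
    S.star v = S.coord ⁻¹' {b | b ∈ S.complex.realization ∧ 0 < b v} := by
  ext p
  simp [star, S.coord_mem p]

/-- The star is star-shaped about its vertex in barycentric coordinates: if q has a positive
coordinate at v, every closed triangle containing q has v as a vertex, so it contains the segment
from q to v. -/
instance (v : Fin S.n) : SimplyConnectedSpace (S.star v) := by
  rw [star_eq]
  refine S.simplyConnectedSpace_coordPreimage (fun b hb => hb.1)
    (b := Pi.single v 1) ⟨S.complex.vertex_mem v, by simp⟩ ?_
  intro q hq a b ha hb hab
  obtain ⟨hq, hqv⟩ := hq
  obtain ⟨t, ht, hqt⟩ := Set.mem_iUnion₂.1 hq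
  refine ⟨S.complex.cell_subset ht (OrientedSurfaceComplex.convex_cell t
    (OrientedSurfaceComplex.vertex_mem_cell (hqt.2 v hqv.ne')) hqt ha hb hab), ?_⟩
  simp only [Pi.add_apply, Pi.smul_apply, Pi.single_eq_same, smul_eq_mul, mul_one]
  rcases ha.eq_or_lt with rfl | ha
  · simp at hab
    simpa [hab] using hqv
  · positivity

/-- A closed triangle in the surface. -/
def cell (t : Fin S.n × Fin S.n × Fin S.n) : Set W :=
  S.coord ⁻¹' OrientedSurfaceComplex.cell t

lemma simplyConnectedSpace_cell {t : Fin S.n × Fin S.n × Fin S.n} (ht : t ∈ S.complex.tri) :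
    SimplyConnectedSpace (S.cell t) :=
  have h : (Pi.single t.1 1 : Fin S.n → ℝ) ∈ OrientedSurfaceComplex.cell t :=
    OrientedSurfaceComplex.vertex_mem_cell (Or.inl rfl)
  S.simplyConnectedSpace_coordPreimage (S.complex.cell_subset ht) h
    ((OrientedSurfaceComplex.convex_cell t).starConvex h)

lemma coord_edgePath {x y : Fin S.n} (h : S.complex.Near x y) (s : unitInterval) :
    S.coord (S.edgePath h s) =
      (1 - (s : ℝ)) • (Pi.single x 1 : Fin S.n → ℝ) + (s : ℝ) • Pi.single y 1 := by
  exact congrArg Subtype.val (S.homeo.symm_apply_apply (S.complex.edgePath h s))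

lemma edgePath_mem_cell {x y : Fin S.n} (h : S.complex.Near x y) {t : Fin S.n × Fin S.n × Fin S.n}
    (hx : x = t.1 ∨ x = t.2.1 ∨ x = t.2.2) (hy : y = t.1 ∨ y = t.2.1 ∨ y = t.2.2)
    (s : unitInterval) : S.edgePath h s ∈ S.cell t := by
  rw [cell, Set.mem_preimage, coord_edgePath]
  exact OrientedSurfaceComplex.convex_cell t (OrientedSurfaceComplex.vertex_mem_cell hx)
    (OrientedSurfaceComplex.vertex_mem_cell hy) (by linarith [s.2.2]) s.2.1 (by ring)

/-- A point of a triangle in the open star of a vertex is joined to the vertex by a path inside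
the triangle and the star. -/
lemma exists_path_to_vertex {t : Fin S.n × Fin S.n × Fin S.n} (ht : t ∈ S.complex.tri) {p : W}
    (hp : p ∈ S.cell t) {v : Fin S.n} (hv : p ∈ S.star v) :
    ∃ γ : Path p (S.vertex v), ∀ s, γ s ∈ S.cell t ∧ γ s ∈ S.star v := by
  have hvt : v = t.1 ∨ v = t.2.1 ∨ v = t.2.2 := hp.2 v (ne_of_gt hv)
  let B : Set (Fin S.n → ℝ) := OrientedSurfaceComplex.cell t ∩ {b | 0 < b v}
  have hB : Convex ℝ B := by
    refine (OrientedSurfaceComplex.convex_cell t).inter ?_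
    exact convex_halfSpace_gt (LinearMap.proj v : (Fin S.n → ℝ) →ₗ[ℝ] ℝ).isLinear 0
  have hvB : (Pi.single v 1 : Fin S.n → ℝ) ∈ B :=
    ⟨OrientedSurfaceComplex.vertex_mem_cell hvt, by simp⟩
  have := S.simplyConnectedSpace_coordPreimage
    (Set.inter_subset_left.trans (S.complex.cell_subset ht)) hvB (hB.starConvex hvB)
  obtain ⟨δ⟩ := PathConnectedSpace.joined (⟨p, hp, hv⟩ : (S.coord ⁻¹' B : Set W))
    ⟨S.vertex v, by rw [Set.mem_preimage, coord_vertex]; exact hvB⟩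
  exact ⟨δ.map (f := Subtype.val) continuous_subtype_val, fun s => (δ s).2⟩

/-- Every homotopy class of paths between vertices is a composition of edges. -/
theorem edgePath_induction
    {C : ∀ x y : Fin S.n, Path.Homotopic.Quotient (S.vertex x) (S.vertex y) → Prop}
    (refl : ∀ x, C x x (.refl _))
    (step : ∀ x y z q (h : S.complex.Near y z), C x y q → C x z (q.trans (.mk (S.edgePath h))))
    (x y : Fin S.n) (q : Path.Homotopic.Quotient (S.vertex x) (S.vertex y)) : C x y q := by
  induction q using Path.Homotopic.Quotient.ind with | mk γ => ?_
  -- Lebesgue subdivision: each piece of `γ` between consecutive times stays in the open star of one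
  -- vertex `v i`.
  obtain ⟨t, ht0, htm, ⟨N, hN⟩, hc⟩ := exists_monotone_Icc_subset_open_cover_unitInterval
    (c := fun v => γ ⁻¹' S.star v) (fun v => (S.isOpen_star v).preimage γ.continuous)
    (fun s _ => Set.mem_iUnion.2 (S.exists_mem_star (γ s)))
  choose v hv using hc
  have hl : ∀ i, γ (t i) ∈ S.star (v i) := fun i => hv i ⟨le_rfl, htm (Nat.le_succ i)⟩
  have hr : ∀ i, γ (t (i + 1)) ∈ S.star (v i) := fun i => hv i ⟨htm (Nat.le_succ i), le_rfl⟩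
  -- The initial part of `γ` up to `t i` is closed up by a path `δ` to the nearby vertex. Allowing
  -- every `δ` in the star makes the induction hypothesis directly usable for the next piece of `γ`
  -- followed by `δ₁`.
  have key : ∀ i, ∀ δ : Path (γ (t i)) (S.vertex (v i)), (∀ s, δ s ∈ S.star (v i)) →
      C x (v i) (.mk (((γ.subpath 0 (t i)).cast γ.source.symm rfl).trans δ)) := by
    intro i
    induction i with
    | zero =>
      intro δ hδ
      have hv0 : v 0 = x := by
        have := hl 0
        rwa [ht0, γ.source, vertex_mem_star] at this
      have hmem : ∀ s, ((γ.subpath 0 (t 0)).cast γ.source.symm rfl).trans δ s ∈ S.star (v 0) := by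
        intro s
        have : ∀ s, γ.subpath 0 (t 0) s ∈ S.star (v 0) := by
          intro s
          have : γ.subpath 0 (t 0) s ∈ Set.range (γ.subpath 0 (t 0)) := ⟨s, rfl⟩
          rw [Path.range_subpath, ht0] at this
          rw [Set.uIcc_self, Set.image_singleton, Set.mem_singleton_iff] at this
          have h0 := hl 0
          rw [ht0] at h0 ⊢
          rw [this]
          exact h0
        rw [Path.trans_apply]
        split_ifs
        · exact this _
        · exact hδ _
      generalize ((γ.subpath 0 (t 0)).cast γ.source.symm rfl).trans δ = ε at hmem
      generalize v 0 = u at *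
      subst hv0
      have := Path.Homotopic.of_forall_mem (S.star u) ε (Path.refl _) hmem
        (fun s => by simp [vertex_mem_star])
      rw [Path.Homotopic.Quotient.eq.2 this]
      exact refl u
    | succ i ih =>
      intro δ hδ
      obtain ⟨T, hT, hpT⟩ := S.exists_mem_cell (γ (t (i + 1)))
      obtain ⟨δ₁, h₁⟩ := S.exists_path_to_vertex hT hpT (hr i)
      obtain ⟨δ₂, h₂⟩ := S.exists_path_to_vertex hT hpT (hl (i + 1))
      -- The division point lies in both stars, so both vertices belong to the triangle containing
      -- it.
      have hnear : S.complex.Near (v i) (v (i + 1)) :=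
        ⟨T, hT, hpT.2 _ (ne_of_gt (hr i)), hpT.2 _ (ne_of_gt (hl (i + 1)))⟩
      have hsub : ∀ s, γ.subpath (t i) (t (i + 1)) s ∈ S.star (v i) := by
        intro s
        have : γ.subpath (t i) (t (i + 1)) s ∈ Set.range (γ.subpath (t i) (t (i + 1))) := ⟨s, rfl⟩
        rw [Path.range_subpath_of_le _ _ _ (htm (Nat.le_succ i))] at this
        obtain ⟨s', hs', h⟩ := this
        rw [← h]
        exact hv i hs'
      have h1 := step _ _ _ _ hnear (ih ((γ.subpath (t i) (t (i + 1))).trans δ₁) fun s => by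
        rw [Path.trans_apply]
        split_ifs
        · exact hsub _
        · exact (h₁ _).2)
      convert h1 using 1
      have := S.simplyConnectedSpace_cell hT
      -- Two homotopies: inside the triangle from `δ₁` followed by the edge to `δ₂`, then inside the
      -- star from `δ₂` to `δ`. This is why `δ₂` must lie in both.
      have e1 : (Path.Homotopic.Quotient.mk δ₁).trans (.mk (S.edgePath hnear)) = .mk δ := by
        rw [← Path.Homotopic.Quotient.mk_trans]
        refine (Path.Homotopic.Quotient.eq.2 (Path.Homotopic.of_forall_mem (S.cell T)
          _ δ₂ (fun s => ?_) fun s => (h₂ s).1)).trans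
          (Path.Homotopic.Quotient.eq.2 (Path.Homotopic.of_forall_mem (S.star (v (i + 1)))
          δ₂ δ (fun s => (h₂ s).2) hδ))
        rw [Path.trans_apply]
        split_ifs
        · exact (h₁ _).1
        · exact S.edgePath_mem_cell _ (hpT.2 _ (ne_of_gt (hr i))) (hpT.2 _ (ne_of_gt (hl (i + 1)))) _
      have e2 : Path.Homotopic.Quotient.trans
          (.mk ((γ.subpath 0 (t i)).cast γ.source.symm rfl)) (.mk (γ.subpath (t i) (t (i + 1)))) =
          .mk ((γ.subpath 0 (t (i + 1))).cast γ.source.symm rfl) := by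
        rw [← Path.Homotopic.Quotient.mk_trans, Path.Homotopic.Quotient.eq]
        exact Path.Homotopic.pathCast ⟨Path.Homotopy.subpathTransSubpath γ 0 (t i) (t (i + 1))⟩
          γ.source.symm rfl
      simp only [Path.Homotopic.Quotient.mk_trans, Path.Homotopic.Quotient.trans_assoc, e1, ← e2]
  have hvN : v N = y := by
    have := hl N
    rwa [hN N le_rfl, γ.target, vertex_mem_star] at this
  have h1 := hN N le_rfl
  have h2 := key N
  generalize t N = tN at h1 h2
  generalize v N = u at h2 hvN
  subst hvN h1
  have h3 := h2 ((Path.refl (S.vertex u)).cast γ.target rfl)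
    (fun s => by simp [vertex_mem_star])
  convert h3 using 1
  rw [Path.subpath_zero_one]
  change _ = Path.Homotopic.Quotient.mk (γ.trans (Path.refl _))
  rw [Path.Homotopic.Quotient.eq]
  exact ⟨(Path.Homotopy.transRefl γ).symm⟩

end ClosedOrientedSurface

/-! ### Coverings defined by flat functions, and their monodromy -/

namespace ClosedOrientedSurface

variable {W : Type} [TopologicalSpace W] (S : ClosedOrientedSurface W)
variable {G : Type*} [Group G]

/-- A function on pairs of vertices which satisfies the cocycle condition on all triangles. -/
def IsFlat (P : Fin S.n → Fin S.n → G) : Prop :=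
  ∀ t ∈ S.complex.tri, ∀ x y z, (x = t.1 ∨ x = t.2.1 ∨ x = t.2.2) →
    (y = t.1 ∨ y = t.2.1 ∨ y = t.2.2) → (z = t.1 ∨ z = t.2.1 ∨ z = t.2.2) →
    P x y * P y z = P x z

lemma edgePath_mem_star_left {x y : Fin S.n} (h : S.complex.Near x y) {s : unitInterval}
    (hs : s < 1) : S.edgePath h s ∈ S.star x := by
  rw [star, Set.mem_ofPred_eq, coord_edgePath]
  have h1 : (s : ℝ) < 1 := hs
  have h0 : 0 ≤ (s : ℝ) * (Pi.single y 1 : Fin S.n → ℝ) x := by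
    refine mul_nonneg s.2.1 ?_
    rw [Pi.single_apply]
    split_ifs <;> norm_num
  simp only [Pi.add_apply, Pi.smul_apply, Pi.single_eq_same, smul_eq_mul]
  linarith

lemma edgePath_mem_star_right {x y : Fin S.n} (h : S.complex.Near x y) {s : unitInterval}
    (hs : 0 < s) : S.edgePath h s ∈ S.star y := by
  rw [star, Set.mem_ofPred_eq, coord_edgePath]
  have h1 : 0 < (s : ℝ) := hs
  have h0 : 0 ≤ (1 - (s : ℝ)) * (Pi.single x 1 : Fin S.n → ℝ) y := by
    refine mul_nonneg (by linarith [s.2.2]) ?_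
    rw [Pi.single_apply]
    split_ifs <;> norm_num
  simp only [Pi.add_apply, Pi.smul_apply, Pi.single_eq_same, smul_eq_mul]
  linarith

variable {S} {P : Fin S.n → Fin S.n → G}

lemma IsFlat.self (hP : S.IsFlat P) (x : Fin S.n) : P x x = 1 := by
  obtain ⟨y, z, h⟩ := S.complex.cover x
  simpa using hP _ h x x x (by simp) (by simp) (by simp)

variable (hP : S.IsFlat P)

/-- The covering of the surface with fibre `G` defined by a flat function. -/
noncomputable def IsFlat.core [TopologicalSpace G] [DiscreteTopology G] :
    FiberBundleCore (Fin S.n) W G where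
  baseSet := S.star
  isOpen_baseSet := S.isOpen_star
  indexAt p := (S.exists_mem_star p).choose
  mem_baseSet_at p := (S.exists_mem_star p).choose_spec
  coordChange i j _ v := P j i * v
  coordChange_self i _ _ v := by rw [hP.self, one_mul]
  continuousOn_coordChange i j :=
    ((continuous_of_discreteTopology (f := fun v => P j i * v)).comp continuous_snd).continuousOn
  -- A point in three stars lies in a triangle that has all three centres among its vertices, so
  -- flatness applies.
  coordChange_comp i j k p hp v := by
    obtain ⟨t, ht, hpt⟩ := S.exists_mem_cell p
    rw [← mul_assoc, hP t ht k j i (hpt.2 _ (ne_of_gt hp.2)) (hpt.2 _ (ne_of_gt hp.1.2))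
      (hpt.2 _ (ne_of_gt hp.1.1))]

section

variable [TopologicalSpace G] [DiscreteTopology G]

lemma IsFlat.isCoveringMap : IsCoveringMap hP.core.proj :=
  IsFiberBundle.isCoveringMap fun x => ⟨hP.core.localTrivAt x, hP.core.mem_localTrivAt_baseSet x⟩

/-- The point of the covering with given coordinates over the star of `v`. -/
noncomputable def IsFlat.point (v : Fin S.n) (p : W) (g : G) : hP.core.TotalSpace :=
  (hP.core.localTriv v).toPartialEquiv.symm (p, g)

lemma IsFlat.point_eq {v u : Fin S.n} {p : W} (hv : p ∈ S.star v) (hu : p ∈ S.star u) (g : G) :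
    hP.point v p g = hP.point u p (P u v * g) := by
  have h := hP.core.coordChange_comp v u (hP.core.indexAt p) p
    ⟨⟨hv, hu⟩, hP.core.mem_baseSet_at p⟩ g
  exact congrArg (Bundle.TotalSpace.mk p) h.symm

lemma IsFlat.continuousAt_point {v : Fin S.n} {p : W} (hv : p ∈ S.star v) (g : G) :
    ContinuousAt (fun p => hP.point v p g) p := by
  have h := (hP.core.localTriv v).toOpenPartialHomeomorph.continuousAt_symm (x := (p, g))
    (by rw [hP.core.mem_localTriv_target]; exact hv)
  exact ContinuousAt.comp (f := fun p => (p, g)) h (by fun_prop)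

/-- The point of the covering over a vertex. -/
noncomputable def IsFlat.vertexPoint (v : Fin S.n) (g : G) :
    hP.core.proj ⁻¹' {S.vertex v} := ⟨hP.point v (S.vertex v) g, rfl⟩

lemma IsFlat.vertexPoint_injective (v : Fin S.n) : Function.Injective (hP.vertexPoint v) := by
  intro g g' h
  have h1 : hP.point v (S.vertex v) g = hP.point v (S.vertex v) g' := congrArg Subtype.val h
  have h2 : P (hP.core.indexAt (S.vertex v)) v * g = P (hP.core.indexAt (S.vertex v)) v * g' :=
    eq_of_heq (Bundle.TotalSpace.mk.inj h1).2
  exact mul_left_cancel h2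

/-- The stars of the two ends cover the edge. The lift has constant coordinate `g` over the star of
`x`, which reads `P y x * g` over the star of `y`; the two descriptions agree on the open edge and
glue to a path `Γ`. -/
lemma IsFlat.monodromy_edgePath {x y : Fin S.n} (h : S.complex.Near x y) (g : G) :
    hP.isCoveringMap.monodromy (.mk (S.edgePath h)) (hP.vertexPoint x g) =
      hP.vertexPoint y (P y x * g) := by
  let Γ : unitInterval → hP.core.TotalSpace := fun s =>
    if s < 1 then hP.point x (S.edgePath h s) g else hP.point y (S.edgePath h s) (P y x * g)
  have hleft : ∀ s, s < 1 → Γ s = hP.point x (S.edgePath h s) g := fun s hs => if_pos hs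
  have hright : ∀ s, 0 < s → Γ s = hP.point y (S.edgePath h s) (P y x * g) := by
    intro s hs
    by_cases h1 : s < 1
    · rw [hleft s h1]
      exact hP.point_eq (S.edgePath_mem_star_left h h1) (S.edgePath_mem_star_right h hs) g
    · exact if_neg h1
  have hcont : Continuous Γ := by
    refine continuous_iff_continuousAt.2 fun s => ?_
    by_cases hs : s < 1
    · have : (fun s => hP.point x (S.edgePath h s) g) =ᶠ[nhds s] Γ := by
        filter_upwards [isOpen_Iio.mem_nhds hs] with s hs using (hleft s hs).symm
      refine ContinuousAt.congr ?_ this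
      exact ContinuousAt.comp (f := S.edgePath h)
        (hP.continuousAt_point (S.edgePath_mem_star_left h hs) g)
        (S.edgePath h).continuous.continuousAt
    · have hs : 0 < s := lt_of_lt_of_le zero_lt_one (not_lt.1 hs)
      have : (fun s => hP.point y (S.edgePath h s) (P y x * g)) =ᶠ[nhds s] Γ := by
        filter_upwards [isOpen_Ioi.mem_nhds hs] with s hs using (hright s hs).symm
      refine ContinuousAt.congr ?_ this
      exact ContinuousAt.comp (f := S.edgePath h)
        (hP.continuousAt_point (S.edgePath_mem_star_right h hs) _)
        (S.edgePath h).continuous.continuousAt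
  let δ : Path (hP.vertexPoint x g).1 (hP.vertexPoint y (P y x * g)).1 :=
    ⟨⟨Γ, hcont⟩, by
      change Γ 0 = _
      rw [hleft 0 zero_lt_one, (S.edgePath h).source]
      rfl, by
      change Γ 1 = _
      rw [hright 1 zero_lt_one, (S.edgePath h).target]
      rfl⟩
  refine hP.isCoveringMap.monodromy_eq_of_map_eq (.mk δ) ?_
  refine congrArg Path.Homotopic.Quotient.mk ?_
  ext s
  by_cases hs : s < 1
  · exact congrArg hP.core.proj (hleft s hs)
  · exact congrArg hP.core.proj (hright s (lt_of_lt_of_le zero_lt_one (not_lt.1 hs)))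

end

/-- The monodromy of a flat function: a functor from the fundamental groupoid. -/
theorem IsFlat.exists_transport (hP : S.IsFlat P) :
    ∃ Θ : ∀ x y : Fin S.n, Path.Homotopic.Quotient (S.vertex x) (S.vertex y) → G,
      (∀ x, Θ x x (.refl _) = 1) ∧
      (∀ x y z q r, Θ x z (q.trans r) = Θ y z r * Θ x y q) ∧
      ∀ x y (h : S.complex.Near x y), Θ x y (.mk (S.edgePath h)) = P y x := by
  let _ : TopologicalSpace G := ⊥
  have _ : DiscreteTopology G := ⟨rfl⟩
  -- Monodromy along an edge is a left multiplication, so it is one along every homotopy class; the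
  -- multiplier is recovered from the value at 1.
  have key : ∀ x y q, ∃ p : G, ∀ g, hP.isCoveringMap.monodromy q (hP.vertexPoint x g) =
      hP.vertexPoint y (p * g) := by
    refine S.edgePath_induction (fun x => ⟨1, fun g => ?_⟩) fun x y z q h => ?_
    · rw [IsCoveringMap.monodromy_refl, one_mul, id]
    · rintro ⟨p, hp⟩
      refine ⟨P z y * p, fun g => ?_⟩
      rw [IsCoveringMap.monodromy_trans_apply, hp, hP.monodromy_edgePath, mul_assoc]
  choose Θ hΘ using key
  have huniq : ∀ x y q p, (∀ g, hP.isCoveringMap.monodromy q (hP.vertexPoint x g) =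
      hP.vertexPoint y (p * g)) → Θ x y q = p := by
    intro x y q p h
    have := hP.vertexPoint_injective y ((hΘ x y q 1).symm.trans (h 1))
    simpa using this
  refine ⟨Θ, fun x => huniq _ _ _ _ fun g => ?_, fun x y z q r => huniq _ _ _ _ fun g => ?_,
    fun x y h => huniq _ _ _ _ fun g => hP.monodromy_edgePath h g⟩
  · rw [IsCoveringMap.monodromy_refl, one_mul, id]
  · rw [IsCoveringMap.monodromy_trans_apply, hΘ, hΘ, mul_assoc]

end ClosedOrientedSurface

/-! ### Group cocycles and twisted simplicial cocycles -/

namespace Path.Homotopic.Quotient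

variable {X : Type*} [TopologicalSpace X] {x y z : X}

lemma symm_trans_cancel_left (q : Path.Homotopic.Quotient x y) (r : Path.Homotopic.Quotient y z) :
    q.symm.trans (q.trans r) = r := by
  rw [← trans_assoc, symm_trans, refl_trans]

lemma trans_symm_cancel_left (q : Path.Homotopic.Quotient x y) (r : Path.Homotopic.Quotient x z) :
    q.trans (q.symm.trans r) = r := by
  rw [← trans_assoc, trans_symm, refl_trans]

end Path.Homotopic.Quotient

lemma NonabCocycle.map_one {π Φ : Type*} [Group π] [Group Φ] [MulDistribMulAction π Φ]
    (α : NonabCocycle π Φ) : α.toFun 1 = 1 := by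
  simpa using α.map_mul 1 1

namespace ClosedOrientedSurface

variable {W : Type} [TopologicalSpace W] (S : ClosedOrientedSurface W) (w : W)

lemma near_symm {x y : Fin S.n} (h : S.complex.Near x y) : S.complex.Near y x := by
  obtain ⟨t, ht, hx, hy⟩ := h
  exact ⟨t, ht, hy, hx⟩

lemma isFlat_edgeLoop : S.IsFlat (S.edgeLoop w) :=
  fun _ ht _ _ _ hx hy hz => S.edgeLoop_mul w ht hx hy hz

/-- The homotopy class of the chosen path from the base point to a vertex. -/
noncomputable def baseClass (x : Fin S.n) : Path.Homotopic.Quotient w (S.vertex x) :=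
  .mk (S.basePath w x)

/-- The loop obtained from a path between vertices by means of the base paths. -/
noncomputable def loop {x y : Fin S.n} (q : Path.Homotopic.Quotient (S.vertex x) (S.vertex y)) :
    FundamentalGroup W w :=
  FundamentalGroup.fromPath ((S.baseClass w x).trans (q.trans (S.baseClass w y).symm))

lemma loop_refl (x : Fin S.n) : S.loop w (.refl (S.vertex x)) = 1 := by
  simp only [loop, Path.Homotopic.Quotient.refl_trans, Path.Homotopic.Quotient.trans_symm]
  rfl

lemma loop_trans {x y z : Fin S.n} (q : Path.Homotopic.Quotient (S.vertex x) (S.vertex y))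
    (r : Path.Homotopic.Quotient (S.vertex y) (S.vertex z)) :
    S.loop w (q.trans r) = S.loop w r * S.loop w q := by
  change _ = Path.Homotopic.Quotient.trans _ _
  simp only [loop, Path.Homotopic.Quotient.trans_assoc,
    Path.Homotopic.Quotient.symm_trans_cancel_left]

lemma loop_edgePath {x y : Fin S.n} (h : S.complex.Near x y) :
    S.loop w (.mk (S.edgePath h)) = S.edgeLoop w y x := by
  rw [edgeLoop, dif_pos h, Path.Homotopic.Quotient.mk_trans, Path.Homotopic.Quotient.mk_trans,
    Path.Homotopic.Quotient.mk_symm, Path.Homotopic.Quotient.trans_assoc]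
  rfl

/-- A loop at the base point, transported to a vertex. -/
noncomputable def vertexLoop (x : Fin S.n) (a : FundamentalGroup W w) :
    Path.Homotopic.Quotient (S.vertex x) (S.vertex x) :=
  (S.baseClass w x).symm.trans (a.toPath.trans (S.baseClass w x))

lemma loop_vertexLoop (x : Fin S.n) (a : FundamentalGroup W w) :
    S.loop w (S.vertexLoop w x a) = a := by
  simp only [loop, vertexLoop, Path.Homotopic.Quotient.trans_assoc,
    Path.Homotopic.Quotient.trans_symm_cancel_left, Path.Homotopic.Quotient.trans_symm,
    Path.Homotopic.Quotient.trans_refl]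

lemma vertexLoop_mul (x : Fin S.n) (a b : FundamentalGroup W w) :
    S.vertexLoop w x (a * b) = (S.vertexLoop w x b).trans (S.vertexLoop w x a) := by
  change (S.baseClass w x).symm.trans ((b.toPath.trans a.toPath).trans (S.baseClass w x)) = _
  simp only [vertexLoop, Path.Homotopic.Quotient.trans_assoc,
    Path.Homotopic.Quotient.trans_symm_cancel_left]

/-- The path between two vertices through the base point. -/
noncomputable def joinClass (x y : Fin S.n) :
    Path.Homotopic.Quotient (S.vertex x) (S.vertex y) :=
  (S.baseClass w x).symm.trans (S.baseClass w y)

lemma loop_joinClass (x y : Fin S.n) : S.loop w (S.joinClass w x y) = 1 := by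
  simp only [loop, joinClass, Path.Homotopic.Quotient.trans_assoc,
    Path.Homotopic.Quotient.trans_symm_cancel_left, Path.Homotopic.Quotient.trans_symm]
  rfl

/-- Both sides reduce to the path from `v` through the base point to `x`, followed by `q`. Under the
transport `Θ` this becomes the gauge relation in `twistedCocycle_surjective`. -/
lemma vertexLoop_trans_joinClass (v : Fin S.n) {x y : Fin S.n}
    (q : Path.Homotopic.Quotient (S.vertex x) (S.vertex y)) :
    (S.vertexLoop w v (S.loop w q)).trans (S.joinClass w v y) = (S.joinClass w v x).trans q := by
  have : (S.loop w q).toPath = (S.baseClass w x).trans (q.trans (S.baseClass w y).symm) := rfl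
  simp only [vertexLoop, joinClass, this, Path.Homotopic.Quotient.trans_assoc,
    Path.Homotopic.Quotient.trans_symm_cancel_left, Path.Homotopic.Quotient.symm_trans,
    Path.Homotopic.Quotient.trans_refl]

section TwistedCocycles

variable (Φ : Type*) [Group Φ] [MulDistribMulAction (FundamentalGroup W w) Φ]

/-- The simplicial cocycles with coefficients in `Φ`, twisted by the action of the fundamental
group. -/
def TwistedCocycle : Type _ :=
  {c : Fin S.n → Fin S.n → Φ // (∀ x y, ¬ S.complex.Near x y → c x y = 1) ∧
    ∀ t ∈ S.complex.tri, ∀ x y z, (x = t.1 ∨ x = t.2.1 ∨ x = t.2.2) →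
      (y = t.1 ∨ y = t.2.1 ∨ y = t.2.2) → (z = t.1 ∨ z = t.2.1 ∨ z = t.2.2) →
      c x y * S.edgeLoop w x y • c y z = c x z}

variable {Φ}

open Classical in
/-- The simplicial cocycle of a cocycle of the fundamental group and a gauge transformation. -/
noncomputable def twistedCocycle (α : NonabCocycle (FundamentalGroup W w) Φ) (f : Fin S.n → Φ) :
    S.TwistedCocycle w Φ :=
  ⟨fun x y => if S.complex.Near x y then
      f x * α.toFun (S.edgeLoop w x y) * (S.edgeLoop w x y • f y)⁻¹ else 1,
    fun _ _ h => if_neg h, fun t ht x y z hx hy hz => by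
      beta_reduce
      rw [if_pos ⟨t, ht, hx, hy⟩, if_pos ⟨t, ht, hy, hz⟩, if_pos ⟨t, ht, hx, hz⟩,
        ← S.edgeLoop_mul w ht hx hy hz, α.map_mul]
      simp only [mul_smul, smul_mul', smul_inv']
      group⟩

/-- Along an edge path the values of c compose, so c determines f(y) α(loop q) (loop q • f(x))⁻¹ for
every class q from x to y. Loops at `v`, where f is known, recover α; the paths through the base
point, whose loop is 1, recover f. -/
lemma twistedCocycle_injective (v : Fin S.n) : Function.Injective
    fun p : NonabCocycle (FundamentalGroup W w) Φ × (Fin S.n → Φ) =>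
      (S.twistedCocycle w p.1 p.2, p.2 v) := by
  rintro ⟨α, f⟩ ⟨β, g⟩ h
  obtain ⟨hc, hv⟩ := Prod.mk.inj h
  dsimp only at hc hv
  have key : ∀ x y (q : Path.Homotopic.Quotient (S.vertex x) (S.vertex y)),
      f y * α.toFun (S.loop w q) * (S.loop w q • f x)⁻¹ =
        g y * β.toFun (S.loop w q) * (S.loop w q • g x)⁻¹ := by
    refine S.edgePath_induction (fun x => ?_) fun x y z q h ih => ?_
    · simp only [loop_refl, NonabCocycle.map_one, one_smul, mul_one, mul_inv_cancel]
    · have he := congrFun (congrFun (congrArg Subtype.val hc) z) y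
      simp only [twistedCocycle, if_pos (S.near_symm h)] at he
      have := congrArg₂ (fun a b => a * S.edgeLoop w z y • b) he ih
      simp only [smul_mul', smul_inv'] at this
      simp only [loop_trans, loop_edgePath, NonabCocycle.map_mul, mul_smul]
      convert this using 1 <;> group
  have hα : α = β := by
    ext a
    have := key v v (S.vertexLoop w v a)
    rw [loop_vertexLoop, hv] at this
    simpa using this
  subst hα
  refine Prod.ext rfl (funext fun x => ?_)
  have := key v x (S.joinClass w v x)
  rw [loop_joinClass, hv] at this
  simpa using this

/-- The twisted condition says that the pairs (c(x,y), g_xy) form a flat function with values in Φ ⋊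
π. Its transport has the loop as second component, so at `v` it is a homomorphism π → Φ ⋊ π
splitting the projection; the first component of such a splitting is a cocycle. -/
lemma twistedCocycle_surjective (v : Fin S.n) : Function.Surjective
    fun p : NonabCocycle (FundamentalGroup W w) Φ × (Fin S.n → Φ) =>
      (S.twistedCocycle w p.1 p.2, p.2 v) := by
  rintro ⟨⟨c, hc₀, hc⟩, φ⟩
  have hP : S.IsFlat (fun x y => (⟨c x y, S.edgeLoop w x y⟩ :
      Φ ⋊[MulDistribMulAction.toMulAut (FundamentalGroup W w) Φ] FundamentalGroup W w)) :=
    fun t ht x y z hx hy hz => SemidirectProduct.ext (hc t ht x y z hx hy hz)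
      (S.edgeLoop_mul w ht hx hy hz)
  obtain ⟨Θ, hΘ₁, hΘ, hΘe⟩ := hP.exists_transport
  have hright : ∀ x y q, (Θ x y q).right = S.loop w q := by
    refine S.edgePath_induction (fun x => ?_) fun x y z q h ih => ?_
    · rw [hΘ₁, loop_refl]
      rfl
    · rw [hΘ, hΘe, loop_trans, loop_edgePath, SemidirectProduct.mul_right, ih]
  -- Conjugation by `φ` in `A`, and multiplication by it in `F`, arrange that the gauge function
  -- takes the prescribed value `φ` at `v`.
  let A : FundamentalGroup W w →
      Φ ⋊[MulDistribMulAction.toMulAut (FundamentalGroup W w) Φ] FundamentalGroup W w := fun a =>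
    (SemidirectProduct.inl φ)⁻¹ * Θ v v (S.vertexLoop w v a) * SemidirectProduct.inl φ
  let F : Fin S.n →
      Φ ⋊[MulDistribMulAction.toMulAut (FundamentalGroup W w) Φ] FundamentalGroup W w := fun x => Θ v x (S.joinClass w v x) * SemidirectProduct.inl φ
  have hA : ∀ a, (A a).right = a := fun a => by
    simp only [A, SemidirectProduct.mul_right, SemidirectProduct.inv_right, hright,
      loop_vertexLoop, SemidirectProduct.right_inl, inv_one, one_mul, mul_one]
  have hF : ∀ x, (F x).right = 1 := fun x => by
    simp only [F, SemidirectProduct.mul_right, hright, loop_joinClass,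
      SemidirectProduct.right_inl, mul_one]
  have hAmul : ∀ a b, A (a * b) = A a * A b := fun a b => by
    simp only [A, vertexLoop_mul, hΘ]
    group
  refine ⟨⟨⟨fun a => (A a).left, fun a b => ?_⟩, fun x => (F x).left⟩, Prod.ext
    (Subtype.ext (funext fun x => funext fun y => ?_)) ?_⟩
  · rw [hAmul, SemidirectProduct.mul_left, hA]
    rfl
  · simp only [twistedCocycle]
    split_ifs with h
    · have h1 := congrArg (Θ v x) (S.vertexLoop_trans_joinClass w v
        (.mk (S.edgePath (S.near_symm h))))
      rw [hΘ, hΘ, loop_edgePath, hΘe] at h1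
      have h2 : F x * A (S.edgeLoop w x y) = ⟨c x y, S.edgeLoop w x y⟩ * F y := by
        simp only [F, A, ← mul_assoc, ← h1]
        group
      have h3 := congrArg SemidirectProduct.left h2
      rw [SemidirectProduct.mul_left, SemidirectProduct.mul_left, hF, map_one] at h3
      exact mul_inv_eq_of_eq_mul h3
    · exact (hc₀ x y h).symm
  · have h1 : Θ v v (S.joinClass w v v) = 1 := by
      have : S.joinClass w v v = .refl _ := Path.Homotopic.Quotient.symm_trans _
      rw [this, hΘ₁]
    simp [F, h1]

/-- The number of cocycles of the fundamental group in terms of simplicial cocycles. -/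
lemma card_twistedCocycle :
    Nat.card (NonabCocycle (FundamentalGroup W w) Φ) * Nat.card Φ ^ S.n =
      Nat.card (S.TwistedCocycle w Φ) * Nat.card Φ := by
  obtain ⟨t, -⟩ := S.complex.nonempty
  have := Nat.card_congr (Equiv.ofBijective _
    ⟨S.twistedCocycle_injective w (Φ := Φ) t.1, S.twistedCocycle_surjective w t.1⟩)
  rwa [Nat.card_prod, Nat.card_prod, Nat.card_fun, Nat.card_fin] at this

lemma finite_nonabCocycle {W : Type} [TopologicalSpace W] (S : ClosedOrientedSurface W) (w : W)
    {Φ : Type*} [Group Φ] [MulDistribMulAction (FundamentalGroup W w) Φ] [Finite Φ] : Finite (NonabCocycle (FundamentalGroup W w) Φ) := by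
  obtain ⟨t, -⟩ := S.complex.nonempty
  have : Finite (S.TwistedCocycle w Φ) := Subtype.finite
  have := Finite.of_injective _ (S.twistedCocycle_injective w (Φ := Φ) t.1)
  exact Finite.of_injective (fun α : NonabCocycle (FundamentalGroup W w) Φ =>
    (α, fun _ : Fin S.n => (1 : Φ))) fun _ _ h => (Prod.mk.inj h).1

end TwistedCocycles

end ClosedOrientedSurface

/-- The measure of the non-abelian cohomology, in terms of the number of cocycles. -/
lemma nonabMeasure_eq (π Φ : Type*) [Group π] [Group Φ] [MulDistribMulAction π Φ] [Finite Φ]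
    [Finite (NonabCocycle π Φ)] :
    nonabMeasure π Φ = (Nat.card (NonabCocycle π Φ) : ℚ) / Nat.card Φ := by
  have : Finite (NonabH1 π Φ) := Quotient.finite _
  have := Fintype.ofFinite (NonabH1 π Φ)
  have hc : (Nat.card Φ : ℚ) ≠ 0 := by exact_mod_cast Nat.card_pos.ne'
  rw [nonabMeasure, finsum_eq_sum_of_fintype, Nat.card_congr
    (MulAction.selfEquivSigmaOrbits Φ (NonabCocycle π Φ)), Nat.card_sigma, Nat.cast_sum,
    Finset.sum_div]
  refine Finset.sum_congr rfl fun h _ => ?_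
  -- Each term 1/|Aut(h)| is thus the size of the orbit h divided by |Φ|.
  have h1 : Nat.card (MulAction.orbit Φ (Quotient.out h)) * Nat.card h.aut = Nat.card Φ := by
    rw [NonabH1.aut, ← Nat.card_prod]
    exact Nat.card_congr (MulAction.orbitProdStabilizerEquivGroup Φ _)
  have h2 : (Nat.card h.aut : ℚ) ≠ 0 := by exact_mod_cast Nat.card_pos.ne'
  rw [← h1]
  push_cast
  have h3 : (Nat.card (MulAction.orbit Φ (Quotient.out h)) : ℚ) ≠ 0 := by
    rw [← h1] at hc
    push_cast at hc
    exact left_ne_zero_of_mul hc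
  field_simp

/-! ### Characters of finite groups -/

namespace IrrRep

variable {Φ : Type*} [Group Φ] {m n : ℕ}

/-- The matrix of a group element. -/
def mat (ρ : IrrRep Φ n) (φ : Φ) : Matrix (Fin n) (Fin n) ℂ := (ρ.hom φ : Matrix (Fin n) (Fin n) ℂ)

lemma mat_one (ρ : IrrRep Φ n) : ρ.mat 1 = 1 := by simp [mat]

lemma mat_mul (ρ : IrrRep Φ n) (φ ψ : Φ) : ρ.mat (φ * ψ) = ρ.mat φ * ρ.mat ψ := by simp [mat]

/-- The class of an irreducible representation. -/
def toIrr (ρ : IrrRep Φ n) : Irr Φ := ⟨n, Quotient.mk _ ρ⟩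

lemma toIrr_eq_iff {ρ ρ' : IrrRep Φ n} : ρ.toIrr = ρ'.toIrr ↔
    ∃ M : GL (Fin n) ℂ, ∀ φ, ρ'.hom φ = M⁻¹ * ρ.hom φ * M := by
  constructor
  · intro h
    exact Quotient.exact (eq_of_heq (Sigma.mk.inj h).2)
  · intro h
    exact congrArg (Sigma.mk n) (Quotient.sound (s := IrrRep.setoid Φ n) h)

lemma _root_.Irr.toIrr_rep (c : Irr Φ) : c.rep.toIrr = c :=
  congrArg (Sigma.mk c.1) (Quotient.out_eq c.2)

/-- Schur's lemma for an intertwiner of two irreducible representations. -/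
lemma toIrr_eq_of_intertwiner (ρ : IrrRep Φ m) (ρ' : IrrRep Φ n) (A : Matrix (Fin m) (Fin n) ℂ)
    (hA : ∀ φ, ρ.mat φ * A = A * ρ'.mat φ) (h : A ≠ 0) : ρ.toIrr = ρ'.toIrr := by
  have hker : LinearMap.ker A.mulVecLin = ⊥ := by
    refine (ρ'.irreducible _ fun φ v hv => ?_).resolve_right fun htop => h ?_
    · rw [LinearMap.mem_ker, Matrix.mulVecLin_apply] at hv ⊢
      change A.mulVec ((ρ'.mat φ).mulVec v) = 0
      rw [Matrix.mulVec_mulVec, ← hA, ← Matrix.mulVec_mulVec, hv, Matrix.mulVec_zero]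
    · rw [LinearMap.ker_eq_top] at htop
      exact Matrix.toLin'.injective (by rw [Matrix.toLin'_apply', htop, map_zero])
  have hrange : LinearMap.range A.mulVecLin = ⊤ := by
    refine (ρ.irreducible _ ?_).resolve_left fun hbot => h ?_
    · rintro φ _ ⟨v, rfl⟩
      refine ⟨(ρ'.mat φ).mulVec v, ?_⟩
      rw [Matrix.mulVecLin_apply, Matrix.mulVecLin_apply, Matrix.mulVec_mulVec, ← hA,
        ← Matrix.mulVec_mulVec]
      rfl
    · rw [LinearMap.range_eq_bot] at hbot
      exact Matrix.toLin'.injective (by rw [Matrix.toLin'_apply', hbot, map_zero])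
  have hmn : m = n := by
    have e := LinearEquiv.ofBijective A.mulVecLin
      ⟨LinearMap.ker_eq_bot.1 hker, LinearMap.range_eq_top.1 hrange⟩
    simpa using e.finrank_eq.symm
  subst hmn
  have hu : IsUnit A := by
    rw [← Matrix.mulVec_injective_iff_isUnit]
    exact LinearMap.ker_eq_bot.1 hker
  obtain ⟨M, rfl⟩ := hu
  refine toIrr_eq_iff.2 ⟨M, fun φ => ?_⟩
  have : ρ.hom φ * M = M * ρ'.hom φ := Units.ext (hA φ)
  rw [mul_assoc, this, inv_mul_cancel_left]

/-- The eigenvalue argument of `schur` without invertibility, since an averaged matrix may vanish.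
-/
lemma exists_eq_smul_one (ρ : IrrRep Φ n) (A : Matrix (Fin n) (Fin n) ℂ)
    (hA : ∀ φ, ρ.mat φ * A = A * ρ.mat φ) : ∃ c : ℂ, A = c • 1 := by
  have : Nonempty (Fin n) := ⟨⟨0, ρ.pos⟩⟩
  obtain ⟨c, hc⟩ := Module.End.exists_eigenvalue (Matrix.toLin' A)
  refine ⟨c, ?_⟩
  have hmem : ∀ v, v ∈ Module.End.eigenspace (Matrix.toLin' A) c ↔ A.mulVec v = c • v :=
    fun v => by rw [Module.End.mem_eigenspace_iff, Matrix.toLin'_apply]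
  have htop : Module.End.eigenspace (Matrix.toLin' A) c = ⊤ := by
    refine (ρ.irreducible _ fun φ v hv => ?_).resolve_left hc
    rw [hmem] at hv ⊢
    change A.mulVec ((ρ.mat φ).mulVec v) = c • (ρ.mat φ).mulVec v
    rw [Matrix.mulVec_mulVec, ← hA, ← Matrix.mulVec_mulVec, hv, Matrix.mulVec_smul]
  refine Matrix.toLin'.injective (LinearMap.ext fun v => ?_)
  have hv : v ∈ Module.End.eigenspace (Matrix.toLin' A) c := htop ▸ Submodule.mem_top
  rw [hmem] at hv
  simp [hv]

section Orthogonality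

variable [Fintype Φ]

/-- Averaging over the group makes any matrix `B` an intertwiner. With `B` a matrix unit the entries
of the average are the sums in Schur orthogonality. -/
lemma mat_mul_sum (ρ : IrrRep Φ m) (ρ' : IrrRep Φ n) (B : Matrix (Fin m) (Fin n) ℂ) (ψ : Φ) :
    ρ.mat ψ * ∑ φ, ρ.mat φ * B * ρ'.mat φ⁻¹ = (∑ φ, ρ.mat φ * B * ρ'.mat φ⁻¹) * ρ'.mat ψ := by
  rw [Matrix.mul_sum, Matrix.sum_mul, ← Equiv.sum_comp (Equiv.mulLeft ψ)
    fun φ => ρ.mat φ * B * ρ'.mat φ⁻¹ * ρ'.mat ψ]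
  refine Finset.sum_congr rfl fun φ _ => ?_
  rw [Equiv.coe_mulLeft, mat_mul, mul_inv_rev, mat_mul, Matrix.mul_assoc (ρ.mat ψ * ρ.mat φ * B),
    Matrix.mul_assoc (ρ'.mat φ⁻¹), ← mat_mul ρ' ψ⁻¹, inv_mul_cancel, mat_one, Matrix.mul_one]
  simp only [Matrix.mul_assoc]

lemma sum_apply (ρ : IrrRep Φ m) (ρ' : IrrRep Φ n) (i j k l) :
    (∑ φ, ρ.mat φ * Matrix.single j k (1 : ℂ) * ρ'.mat φ⁻¹) i l =
      ∑ φ, ρ.mat φ i j * ρ'.mat φ⁻¹ k l := by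
  rw [Matrix.sum_apply]
  refine Finset.sum_congr rfl fun φ _ => ?_
  rw [Matrix.mul_apply, Finset.sum_eq_single k]
  · simp
  · intro b _ hb
    rw [Matrix.mul_single_apply_of_ne _ _ _ _ _ hb, zero_mul]
  · simp

/-- Schur orthogonality for two inequivalent representations. -/
lemma sum_mat_mul_mat_eq_zero (ρ : IrrRep Φ m) (ρ' : IrrRep Φ n) (h : ρ.toIrr ≠ ρ'.toIrr)
    (i j k l) : ∑ φ, ρ.mat φ i j * ρ'.mat φ⁻¹ k l = 0 := by
  rw [← sum_apply]
  by_contra hne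
  refine h (ρ.toIrr_eq_of_intertwiner ρ' _ (ρ.mat_mul_sum ρ' (Matrix.single j k (1 : ℂ))) fun h0 => ?_)
  rw [h0] at hne
  exact hne rfl

/-- Schur orthogonality for one representation. -/
lemma sum_mat_mul_mat (ρ : IrrRep Φ n) (i j k l) :
    ∑ φ, ρ.mat φ i j * ρ.mat φ⁻¹ k l =
      (Fintype.card Φ / n : ℂ) * if i = l ∧ j = k then 1 else 0 := by
  obtain ⟨c, hc⟩ := ρ.exists_eq_smul_one _ (ρ.mat_mul_sum ρ (Matrix.single j k (1 : ℂ)))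
  have hn : (n : ℂ) ≠ 0 := Nat.cast_ne_zero.2 ρ.pos.ne'
  -- The average is a scalar matrix; its trace determines the scalar.
  have htr := congrArg Matrix.trace hc
  have h1 : ∀ φ, (ρ.mat φ * Matrix.single j k (1 : ℂ) * ρ.mat φ⁻¹).trace = if j = k then 1 else 0 := by
    intro φ
    rw [Matrix.trace_mul_cycle, ← mat_mul, inv_mul_cancel, mat_one, Matrix.one_mul]
    split_ifs with h
    · rw [h, Matrix.trace_single_eq_same]
    · rw [Matrix.trace_single_eq_of_ne _ _ _ h]
  rw [Matrix.trace_sum, Finset.sum_congr rfl fun φ _ => h1 φ, Finset.sum_const, Finset.card_univ,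
    Matrix.trace_smul, Matrix.trace_one, Fintype.card_fin, nsmul_eq_mul, smul_eq_mul] at htr
  rw [← sum_apply, hc, Matrix.smul_apply, Matrix.one_apply, smul_eq_mul, ← div_eq_iff hn |>.2 htr]
  split_ifs <;> simp_all

end Orthogonality

/-- The character of a representation. -/
def char (ρ : IrrRep Φ n) (φ : Φ) : ℂ := (ρ.mat φ).trace

lemma char_mul_comm (ρ : IrrRep Φ n) (φ ψ : Φ) : ρ.char (φ * ψ) = ρ.char (ψ * φ) := by
  rw [char, char, mat_mul, mat_mul, Matrix.trace_mul_comm]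

lemma char_eq_of_toIrr_eq (ρ : IrrRep Φ m) (ρ' : IrrRep Φ n) (h : ρ.toIrr = ρ'.toIrr) (φ : Φ) :
    ρ.char φ = ρ'.char φ := by
  have hmn : m = n := congrArg Sigma.fst h
  subst hmn
  obtain ⟨M, hM⟩ := toIrr_eq_iff.1 h
  rw [char, char, mat, mat, hM φ, Units.val_mul, Units.val_mul, Matrix.trace_mul_cycle,
    ← Units.val_mul, mul_inv_cancel, Units.val_one, Matrix.one_mul]

lemma char_mul (ρ : IrrRep Φ n) (φ ψ : Φ) :
    ρ.char (φ * ψ) = ∑ p : Fin n × Fin n, ρ.mat φ p.1 p.2 * ρ.mat ψ p.2 p.1 := by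
  rw [char, mat_mul, Matrix.trace, Fintype.sum_prod_type]
  rfl

/-- The translates `u` and `v` are the remaining holonomies of the two triangles adjacent to an edge
when only the value at that edge is averaged. -/
lemma sum_char_mul_char [Fintype Φ] (ρ : IrrRep Φ m) (ρ' : IrrRep Φ n) (h : ρ.toIrr ≠ ρ'.toIrr)
    (u v : Φ) : ∑ φ, ρ.char (φ * u) * ρ'.char (φ⁻¹ * v) = 0 := by
  simp only [char_mul, Finset.sum_mul_sum]
  rw [Finset.sum_comm]
  refine Finset.sum_eq_zero fun p _ => ?_
  rw [Finset.sum_comm]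
  refine Finset.sum_eq_zero fun q _ => ?_
  rw [Finset.sum_congr rfl fun φ _ => mul_mul_mul_comm _ _ _ _, ← Finset.sum_mul,
    ρ.sum_mat_mul_mat_eq_zero ρ' h, zero_mul]

lemma sum_char_mul_char_self [Fintype Φ] (ρ : IrrRep Φ n) :
    ∑ φ, ρ.char φ * ρ.char φ⁻¹ = Fintype.card Φ := by
  have hn : (n : ℂ) ≠ 0 := Nat.cast_ne_zero.2 ρ.pos.ne'
  simp only [char, Matrix.trace, Matrix.diag_apply, Finset.sum_mul_sum]
  rw [Finset.sum_comm]
  have : ∀ i, ∑ φ, ∑ j, ρ.mat φ i i * ρ.mat φ⁻¹ j j = Fintype.card Φ / n := by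
    intro i
    rw [Finset.sum_comm]
    simp [sum_mat_mul_mat]
  simp only [this, Finset.sum_const, Finset.card_univ, Fintype.card_fin, nsmul_eq_mul]
  field_simp

lemma toIrr_eq_of_char_eq [Finite Φ] (ρ : IrrRep Φ m) (ρ' : IrrRep Φ n)
    (h : ∀ φ, ρ.char φ = ρ'.char φ) : ρ.toIrr = ρ'.toIrr := by
  have := Fintype.ofFinite Φ
  by_contra hne
  have h1 := ρ.sum_char_mul_char ρ' hne 1 1
  simp only [mul_one, ← h, sum_char_mul_char_self] at h1
  exact Fintype.card_ne_zero (Nat.cast_eq_zero.1 h1)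

end IrrRep

lemma Irr.eq_of_char_eq {Φ : Type*} [Group Φ] [Finite Φ] (c c' : Irr Φ)
    (h : ∀ φ, c.rep.char φ = c'.rep.char φ) : c = c' := by
  rw [← c.toIrr_rep, ← c'.toIrr_rep]
  exact c.rep.toIrr_eq_of_char_eq c'.rep h

/-- By orthogonality the irreducible characters are linearly independent in the finite-dimensional
space of functions on Φ. -/
instance (Φ : Type*) [Group Φ] [Finite Φ] : Finite (Irr Φ) := by
  have := Fintype.ofFinite Φ
  have hli : LinearIndependent ℂ fun c : Irr Φ => c.rep.char := by
    rw [linearIndependent_iff']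
    intro s a ha c hc
    have h1 : ∑ φ, (∑ c ∈ s, a c • c.rep.char) φ * c.rep.char φ⁻¹ = 0 := by
      simp only [ha, Pi.zero_apply, zero_mul, Finset.sum_const_zero]
    simp only [Finset.sum_apply, Pi.smul_apply, smul_eq_mul, Finset.sum_mul] at h1
    rw [Finset.sum_comm, Finset.sum_eq_single c] at h1
    · simp only [mul_assoc, ← Finset.mul_sum, IrrRep.sum_char_mul_char_self] at h1
      simpa using h1
    · intro b _ hb
      have := b.rep.sum_char_mul_char c.rep (by rwa [Irr.toIrr_rep, Irr.toIrr_rep]) 1 1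
      simp only [mul_one] at this
      simp only [mul_assoc, ← Finset.mul_sum, this, mul_zero]
    · exact fun h => absurd hc h
  exact hli.finite

open Classical in
/-- A function on a finite group which vanishes in all irreducible representations is zero. -/
lemma eq_zero_of_sum_smul_mat {Φ : Type*} [Group Φ] [Fintype Φ] (f : Φ → ℂ)
    (hf : ∀ c : Irr Φ, ∑ φ, f φ • c.rep.mat φ = 0) : f = 0 := by
  have : NeZero (Nat.card Φ : ℂ) := ⟨by exact_mod_cast Nat.card_pos.ne'⟩
  -- Maschke and Wedderburn: the group algebra is a product of matrix algebras, and each factor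
  -- gives an irreducible representation. An element killed by all of them is zero.
  obtain ⟨k, d, hd, ⟨e⟩⟩ :=
    IsSemisimpleRing.exists_algEquiv_pi_matrix_of_isAlgClosed ℂ (MonoidAlgebra ℂ Φ)
  let r (i : Fin k) : MonoidAlgebra ℂ Φ →ₐ[ℂ] Matrix (Fin (d i)) (Fin (d i)) ℂ :=
    (Pi.evalAlgHom ℂ _ i).comp e.toAlgHom
  have hr : ∀ i, Function.Surjective (r i) := fun i =>
    (Function.surjective_eval i).comp e.surjective
  have hsum : ∀ x, ∃ g : Φ → ℂ, ∀ i, r i x = ∑ φ, g φ • r i (MonoidAlgebra.single φ 1) := by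
    intro x
    induction x using MonoidAlgebra.induction_linear with
    | zero => exact ⟨0, fun i => by simp⟩
    | add x y hx hy =>
      obtain ⟨g, hg⟩ := hx
      obtain ⟨g', hg'⟩ := hy
      exact ⟨g + g', fun i => by
        simp only [map_add, hg, hg', Pi.add_apply, add_smul, Finset.sum_add_distrib]⟩
    | single φ a =>
      refine ⟨Pi.single φ a, fun i => ?_⟩
      rw [Finset.sum_eq_single φ (fun b _ hb => by rw [Pi.single_eq_of_ne hb, zero_smul])
        (by simp), Pi.single_eq_same, ← map_smul, MonoidAlgebra.smul_single, smul_eq_mul, mul_one]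
  let ρ (i : Fin k) : IrrRep Φ (d i) :=
    { hom := ((r i : MonoidAlgebra ℂ Φ →* Matrix (Fin (d i)) (Fin (d i)) ℂ).comp
        (MonoidAlgebra.of ℂ Φ)).toHomUnits
      pos := Nat.pos_of_ne_zero (hd i).out
      irreducible := by
        intro V hV
        have hV' : ∀ A : Matrix (Fin (d i)) (Fin (d i)) ℂ, ∀ v ∈ V, A.mulVec v ∈ V := by
          intro A v hv
          obtain ⟨x, rfl⟩ := hr i A
          obtain ⟨g, hg⟩ := hsum x
          rw [hg, Matrix.sum_mulVec]
          refine V.sum_mem fun φ _ => ?_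
          rw [Matrix.smul_mulVec]
          exact V.smul_mem _ (hV φ v hv)
        by_contra! h
        obtain ⟨v, hv, hv0⟩ := V.ne_bot_iff.1 h.1
        obtain ⟨j, hj⟩ := Function.ne_iff.1 hv0
        refine h.2 (V.eq_top_iff'.2 fun u => ?_)
        -- This rank-one matrix sends `v` to the arbitrary vector `u`, so a nonzero invariant
        -- subspace is everything.
        have := hV' (Matrix.vecMulVec u (Pi.single j (v j)⁻¹)) v hv
        rwa [Matrix.vecMulVec_mulVec, single_dotProduct, inv_mul_cancel₀ hj, MulOpposite.op_one,
          one_smul] at this }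
  have h0 : ∀ i, ∑ φ, f φ • (ρ i).mat φ = 0 := by
    intro i
    have h1 := hf (ρ i).toIrr
    obtain ⟨M, hM⟩ := IrrRep.toIrr_eq_iff.1 ((ρ i).toIrr.toIrr_rep)
    let N : GL (Fin (d i)) ℂ := M
    let A : Φ → Matrix (Fin (d i)) (Fin (d i)) ℂ := (ρ i).toIrr.rep.mat
    have h2 : ∀ φ, (ρ i).mat φ = ((N⁻¹ : GL (Fin (d i)) ℂ) : Matrix (Fin (d i)) (Fin (d i)) ℂ) *
        A φ * N :=
      fun φ => congrArg Units.val (hM φ)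
    have h3 : ∀ φ, f φ • (ρ i).mat φ =
        ((N⁻¹ : GL (Fin (d i)) ℂ) : Matrix (Fin (d i)) (Fin (d i)) ℂ) * (f φ • A φ) *
          ((N : GL (Fin (d i)) ℂ) : Matrix (Fin (d i)) (Fin (d i)) ℂ) := fun φ => by
      rw [h2, Matrix.mul_smul, Matrix.smul_mul]
    simp only [h3]
    rw [← Matrix.sum_mul, ← Matrix.mul_sum]
    have h4 : ∑ φ, f φ • A φ = 0 := h1
    rw [h4, Matrix.mul_zero, Matrix.zero_mul]
  have hx : ∑ φ, f φ • MonoidAlgebra.single φ (1 : ℂ) = 0 := by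
    refine e.injective ?_
    rw [map_zero]
    refine funext fun i => ?_
    change r i _ = 0
    rw [map_sum, ← h0 i]
    exact Finset.sum_congr rfl fun φ _ => map_smul _ _ _
  ext φ
  have := congrArg (fun x => x.coeff φ) hx
  simpa [Finsupp.single_apply, Finsupp.finsetSum_apply] using this

-- The difference of the two sides, taken at `φ⁻¹`, acts as zero in every irreducible
-- representation: there δ₁ and the character sum both act as the scalar |Φ|. The inverse matches
-- the form of Schur orthogonality.
open Classical in
lemma sum_dim_mul_char {Φ : Type*} [Group Φ] [Fintype Φ] [Fintype (Irr Φ)] (φ : Φ) :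
    ∑ c : Irr Φ, (c.dim : ℂ) * c.rep.char φ = if φ = 1 then (Fintype.card Φ : ℂ) else 0 := by
  have h := eq_zero_of_sum_smul_mat (fun φ : Φ => (if φ = 1 then (Fintype.card Φ : ℂ) else 0) -
    ∑ c : Irr Φ, (c.dim : ℂ) * c.rep.char φ⁻¹) fun c => ?_
  · have := congrFun h φ⁻¹
    simp only [inv_eq_one, inv_inv, Pi.zero_apply, sub_eq_zero] at this
    exact this.symm
  have hδ : ∑ φ : Φ, (if φ = 1 then (Fintype.card Φ : ℂ) else 0) • c.rep.mat φ =
      (Fintype.card Φ : ℂ) • 1 := by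
    rw [Finset.sum_eq_single 1 (fun b _ hb => by rw [if_neg hb, zero_smul]) (by simp), if_pos rfl,
      IrrRep.mat_one]
  simp only [sub_smul, Finset.sum_sub_distrib]
  rw [hδ, sub_eq_zero]
  ext k l
  have hn : (c.dim : ℂ) ≠ 0 := Nat.cast_ne_zero.2 c.rep.pos.ne'
  simp only [Matrix.smul_apply, Matrix.sum_apply, Matrix.one_apply, smul_eq_mul, Finset.sum_mul]
  rw [Finset.sum_comm, Finset.sum_eq_single c]
  · have h1 : ∀ φ, (c.dim : ℂ) * c.rep.char φ⁻¹ * c.rep.mat φ k l =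
        ∑ i, c.dim * (c.rep.mat φ k l * c.rep.mat φ⁻¹ i i) := by
      intro φ
      rw [IrrRep.char, Matrix.trace, ← Finset.mul_sum, ← Finset.mul_sum]
      simp only [Matrix.diag_apply]
      ring
    simp only [h1]
    rw [Finset.sum_comm]
    simp only [← Finset.mul_sum, IrrRep.sum_mat_mul_mat]
    by_cases hkl : k = l
    · subst hkl
      rw [Finset.sum_eq_single k]
      · simp
        field_simp
      · intro b _ hb
        rw [if_neg (fun h => hb h.1.symm)]
      · simp
    · have : ∀ i, ¬ (k = i ∧ l = i) := fun i h => hkl (h.1.trans h.2.symm)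
      simp [hkl, this]
  · intro b _ hb
    have h1 : ∀ φ, (b.dim : ℂ) * b.rep.char φ⁻¹ * c.rep.mat φ k l =
        ∑ i, b.dim * (c.rep.mat φ k l * b.rep.mat φ⁻¹ i i) := by
      intro φ
      rw [IrrRep.char, Matrix.trace, ← Finset.mul_sum, ← Finset.mul_sum]
      simp only [Matrix.diag_apply]
      ring
    simp only [h1]
    rw [Finset.sum_comm]
    simp only [← Finset.mul_sum, c.rep.sum_mat_mul_mat_eq_zero b.rep
      (by rwa [Irr.toIrr_rep, Irr.toIrr_rep, ne_comm]), mul_zero, Finset.sum_const_zero]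
  · simp

/-! ### Darts of an oriented surface complex -/

namespace OrientedSurfaceComplex

variable {n : ℕ} (K : OrientedSurfaceComplex n)

/-- A dart: a triangle with a distinguished oriented edge. -/
abbrev Dart : Type := {t : Fin n × Fin n × Fin n // t ∈ K.tri}

namespace Dart

variable {K}

/-- The source of the oriented edge. -/
def src (d : K.Dart) : Fin n := d.1.1

/-- The target of the oriented edge. -/
def tgt (d : K.Dart) : Fin n := d.1.2.1

/-- The vertex opposite to the edge. -/
def opp (d : K.Dart) : Fin n := d.1.2.2

lemma mem (d : K.Dart) : (d.src, d.tgt, d.opp) ∈ K.tri := d.2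

/-- The next dart in the same triangle. -/
def rot (d : K.Dart) : K.Dart := ⟨(d.tgt, d.opp, d.src), K.rotate _ _ _ d.2⟩

/-- The opposite dart in the adjacent triangle. -/
noncomputable def flip (d : K.Dart) : K.Dart :=
  ⟨(d.tgt, d.src, (K.adjacent _ _ _ d.mem).choose), (K.adjacent _ _ _ d.mem).choose_spec.1⟩

@[simp] lemma src_rot (d : K.Dart) : d.rot.src = d.tgt := rfl
@[simp] lemma tgt_rot (d : K.Dart) : d.rot.tgt = d.opp := rfl
@[simp] lemma opp_rot (d : K.Dart) : d.rot.opp = d.src := rfl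
@[simp] lemma rot_rot_rot (d : K.Dart) : d.rot.rot.rot = d := rfl

/-- A triangle is determined by an oriented edge: the third vertex is the unique one given by
`adjacent` for the opposite dart. -/
lemma ext_src_tgt {d d' : K.Dart} (h : d.src = d'.src) (h' : d.tgt = d'.tgt) : d = d' := by
  obtain ⟨⟨x, y, z⟩, hd⟩ := d
  obtain ⟨⟨x', y', z'⟩, hd'⟩ := d'
  obtain rfl : x = x' := h
  obtain rfl : y = y' := h'
  obtain ⟨v, hv, -⟩ := K.adjacent _ _ _ hd
  obtain rfl : z = z' := (K.adjacent _ _ _ hv).unique hd hd'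
  rfl

@[simp] lemma flip_flip (d : K.Dart) : d.flip.flip = d := ext_src_tgt rfl rfl

lemma src_ne_tgt (d : K.Dart) : d.src ≠ d.tgt := K.distinct _ _ _ d.mem

lemma tgt_ne_opp (d : K.Dart) : d.tgt ≠ d.opp := d.rot.src_ne_tgt

lemma opp_ne_src (d : K.Dart) : d.opp ≠ d.src := d.rot.rot.src_ne_tgt

lemma flip_ne_rot (d : K.Dart) : d.flip ≠ d.rot := fun h => d.opp_ne_src (congrArg tgt h).symm

lemma flip_ne_rot_rot (d : K.Dart) : d.flip ≠ d.rot.rot :=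
  fun h => d.tgt_ne_opp (congrArg src h)

lemma flip_ne (d : K.Dart) : d.flip ≠ d := fun h => d.src_ne_tgt (congrArg src h).symm

lemma rot_ne (d : K.Dart) : d.rot ≠ d := fun h => d.src_ne_tgt (congrArg src h).symm

lemma rot_rot_ne (d : K.Dart) : d.rot.rot ≠ d := fun h => d.opp_ne_src (congrArg src h)

/-- A function on darts which is invariant under turning around the source is a function of the
source. -/
lemma exists_eq_comp_src {β : Type*} (I : K.Dart → β) (hI : ∀ d, I d.flip.rot = I d) :
    ∃ f : Fin n → β, ∀ d, I d = f d.src := by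
  have key : ∀ d d' : K.Dart, d.src = d'.src → I d = I d' := by
    rintro ⟨⟨x, y, z⟩, hd⟩ ⟨⟨x', y', z'⟩, hd'⟩ h
    obtain rfl : x = x' := h
    -- Induction along the polygon around `x`; `flip` followed by `rot` moves back by one step of
    -- the link.
    have : ∀ y', Relation.ReflTransGen (fun a b => (x, a, b) ∈ K.tri) y y' →
        ∀ d' : K.Dart, d'.src = x → d'.tgt = y' → I ⟨(x, y, z), hd⟩ = I d' := by
      intro y' hy
      induction hy with
      | refl => exact fun d' h h' => congrArg I (ext_src_tgt h.symm h'.symm)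
      | tail _ hab ih =>
        intro d' h h'
        rw [ih ⟨_, hab⟩ rfl rfl, ← hI d']
        refine congrArg I (ext_src_tgt h.symm ?_)
        have : d'.flip = ⟨_, K.rotate _ _ _ (K.rotate _ _ _ hab)⟩ := ext_src_tgt h' h
        rw [this]
        rfl
    exact this y' (K.link x y z y' z' hd hd') _ rfl rfl
  choose y z h using K.cover
  exact ⟨fun x => I ⟨_, h x⟩, fun d => key _ _ rfl⟩

end Dart

/-- The darts that are positively directed edges. -/
abbrev Edge : Type := {d : K.Dart // d.src < d.tgt}

/-- The darts whose source is the smallest vertex of the triangle. -/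
abbrev Triangle : Type := {d : K.Dart // d.src < d.tgt ∧ d.src < d.opp}

variable {K}

/-- A dart is an edge or the opposite of an edge. -/
noncomputable def nonEdgeEquiv : {d : K.Dart // ¬ d.src < d.tgt} ≃ K.Edge where
  toFun d := ⟨d.1.flip, lt_of_le_of_ne (not_lt.1 d.2) d.1.src_ne_tgt.symm⟩
  invFun e := ⟨e.1.flip, not_lt.2 e.2.le⟩
  left_inv d := by simp
  right_inv e := by simp

lemma prod_dart {R : Type*} [CommMonoid R] (F : K.Dart → R) :
    ∏ d, F d = ∏ e : K.Edge, F e.1 * F e.1.flip := by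
  rw [← Fintype.prod_subtype_mul_prod_subtype (fun d : K.Dart => d.src < d.tgt) F,
    Finset.prod_mul_distrib, ← Equiv.prod_comp nonEdgeEquiv.symm]
  rfl

/-- The three darts of a triangle. -/
def corner (p : K.Triangle × Fin 3) : K.Dart := ![p.1.1, p.1.1.rot, p.1.1.rot.rot] p.2

lemma rot_corner (t : K.Triangle) (k : Fin 3) : (corner (t, k)).rot = corner (t, k + 1) := by
  fin_cases k <;> rfl

/-- Exactly one of the three rotations of a dart starts at the smallest vertex of its triangle. -/
lemma corner_bijective : Function.Bijective (corner (K := K)) := by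
  constructor
  · rintro ⟨⟨d, h⟩, k⟩ ⟨⟨d', h'⟩, k'⟩ hdd
    have key : d = d' → k = k' → ((⟨d, h⟩, k) : K.Triangle × Fin 3) = (⟨d', h'⟩, k') := by
      rintro rfl rfl
      rfl
    have hs : ∀ a b : K.Dart, a = b → a.src = b.src ∧ a.tgt = b.tgt ∧ a.opp = b.opp := by
      rintro a _ rfl
      exact ⟨rfl, rfl, rfl⟩
    obtain ⟨h1, h2, h3⟩ := hs _ _ hdd
    have hrot : ∀ a b : K.Dart, a.rot = b.rot → a = b := fun a b hab =>
      congrArg (fun d => d.rot.rot) hab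
    fin_cases k <;> fin_cases k'
    · exact key hdd rfl
    · change d.src = d'.tgt at h1; change d.tgt = d'.opp at h2; change d.opp = d'.src at h3
      omega
    · change d.src = d'.opp at h1; change d.tgt = d'.src at h2; change d.opp = d'.tgt at h3
      omega
    · change d.tgt = d'.src at h1; change d.opp = d'.tgt at h2; change d.src = d'.opp at h3
      omega
    · exact key (hrot _ _ hdd) rfl
    · change d.tgt = d'.opp at h1; change d.opp = d'.src at h2; change d.src = d'.tgt at h3
      omega
    · change d.opp = d'.src at h1; change d.src = d'.tgt at h2; change d.tgt = d'.opp at h3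
      omega
    · change d.opp = d'.tgt at h1; change d.src = d'.opp at h2; change d.tgt = d'.src at h3
      omega
    · exact key (hrot _ _ (hrot _ _ hdd)) rfl
  · intro d
    have h1 := d.src_ne_tgt
    have h2 := d.tgt_ne_opp
    have h3 := d.opp_ne_src
    by_cases ha : d.src < d.tgt ∧ d.src < d.opp
    · exact ⟨(⟨d, ha⟩, 0), rfl⟩
    · by_cases hb : d.rot.src < d.rot.tgt ∧ d.rot.src < d.rot.opp
      · exact ⟨(⟨d.rot, hb⟩, 2), rfl⟩
      · refine ⟨(⟨d.rot.rot, ?_⟩, 1), rfl⟩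
        simp only [Dart.src_rot, Dart.tgt_rot, Dart.opp_rot] at hb ⊢
        omega

/-- Darts are the corners of triangles. -/
noncomputable def cornerEquiv : K.Triangle × Fin 3 ≃ K.Dart := Equiv.ofBijective _ corner_bijective

variable (K) in
lemma card_edge : Fintype.card K.Edge = K.edgeCount := by
  rw [edgeCount, ← Fintype.card_coe]
  refine Fintype.card_congr (Equiv.ofBijective (fun e => ⟨(e.1.src, e.1.tgt), ?_⟩) ⟨?_, ?_⟩)
  · simpa using ⟨e.2, _, e.1.mem⟩
  · intro e e' h
    have : (e.1.src, e.1.tgt) = (e'.1.src, e'.1.tgt) := congrArg Subtype.val h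
    exact Subtype.ext (Dart.ext_src_tgt (Prod.mk.inj this).1 (Prod.mk.inj this).2)
  · rintro ⟨⟨x, y⟩, h⟩
    obtain ⟨hxy, z, hz⟩ : x < y ∧ ∃ z, (x, y, z) ∈ K.tri := by simpa using h
    exact ⟨⟨⟨_, hz⟩, hxy⟩, rfl⟩

/-- The vertices of a triangle in increasing order. -/
def Triangle.sorted (t : K.Triangle) : Fin n × Fin n × Fin n :=
  if t.1.tgt < t.1.opp then (t.1.src, t.1.tgt, t.1.opp) else (t.1.src, t.1.opp, t.1.tgt)

/-- Two triangles with the same sorted vertices but opposite cyclic orders would be both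
orientations of one triangle, contrary to `oriented`. -/
lemma Triangle.sorted_injective : Function.Injective (Triangle.sorted (K := K)) := by
  intro t t' h
  unfold Triangle.sorted at h
  have hor : ∀ d d' : K.Dart, d.src = d'.src → d.tgt = d'.opp → d.opp ≠ d'.tgt := by
    intro d d' h1 h2 h3
    have h4 := d.mem
    rw [h1, h2, h3, K.rotate_iff, K.rotate_iff] at h4
    exact K.oriented _ _ _ h4 d'.mem
  split_ifs at h with h1 h2 h2
  · simp only [Prod.mk.injEq] at h
    exact Subtype.ext (Dart.ext_src_tgt h.1 h.2.1)
  · simp only [Prod.mk.injEq] at h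
    exact absurd h.2.2 (hor _ _ h.1 h.2.1)
  · simp only [Prod.mk.injEq] at h
    exact absurd h.2.1 (hor _ _ h.1 h.2.2)
  · simp only [Prod.mk.injEq] at h
    exact Subtype.ext (Dart.ext_src_tgt h.1 h.2.2)

lemma Triangle.sorted_lt (t : K.Triangle) :
    t.sorted.1 < t.sorted.2.1 ∧ t.sorted.2.1 < t.sorted.2.2 := by
  unfold Triangle.sorted
  have := t.1.tgt_ne_opp
  split_ifs with h
  · exact ⟨t.2.1, h⟩
  · exact ⟨t.2.2, by dsimp only; omega⟩

lemma Triangle.exists_sorted_eq {x y z : Fin n} (hxy : x < y) (hyz : y < z)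
    (h : (x, y, z) ∈ K.tri ∨ (y, x, z) ∈ K.tri) : ∃ t : K.Triangle, t.sorted = (x, y, z) := by
  rcases h with h | h
  · exact ⟨⟨⟨_, h⟩, hxy, hxy.trans hyz⟩, if_pos hyz⟩
  · exact ⟨⟨⟨_, K.rotate _ _ _ h⟩, hxy.trans hyz, hxy⟩, if_neg (not_lt.2 hyz.le)⟩

lemma Triangle.sorted_mem (t : K.Triangle) : t.sorted ∈ K.tri ∨
    (t.sorted.2.1, t.sorted.1, t.sorted.2.2) ∈ K.tri := by
  unfold Triangle.sorted
  split_ifs with h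
  · exact Or.inl t.1.mem
  · exact Or.inr (K.rotate _ _ _ (K.rotate _ _ _ t.1.mem))

variable (K) in
lemma card_triangle : Fintype.card K.Triangle = K.triangleCount := by
  rw [triangleCount, ← Finset.card_univ]
  refine Finset.card_bij (fun t _ => t.sorted) (fun t _ => ?_)
    (fun t _ t' _ h => Triangle.sorted_injective h) fun p hp => ?_
  · simpa using ⟨t.sorted_lt.1, t.sorted_lt.2, t.sorted_mem⟩
  · obtain ⟨h1, h2, h3⟩ : p.1 < p.2.1 ∧ p.2.1 < p.2.2 ∧
      (p ∈ K.tri ∨ (p.2.1, p.1, p.2.2) ∈ K.tri) := by simpa using hp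
    obtain ⟨t, ht⟩ := Triangle.exists_sorted_eq h1 h2 h3
    exact ⟨t, Finset.mem_univ _, ht⟩

end OrientedSurfaceComplex

/-! ### State sums -/

/-- Schur orthogonality identifies the inner indices, so `M⁻¹` and `M` are contracted to the
identity and the value does not depend on `M`. -/
lemma IrrRep.sum_mat_mul_conj {Φ : Type*} [Group Φ] [Fintype Φ] {m : ℕ} (ρ : IrrRep Φ m)
    (M : GL (Fin m) ℂ) (i j k l : Fin m) :
    ∑ φ, (ρ.mat φ * (M : Matrix (Fin m) (Fin m) ℂ)) i j *
        (((M⁻¹ : GL (Fin m) ℂ) : Matrix (Fin m) (Fin m) ℂ) * ρ.mat φ⁻¹) k l =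
      (Fintype.card Φ / m : ℂ) * if i = l ∧ j = k then 1 else 0 := by
  simp only [Matrix.mul_apply, Finset.sum_mul_sum]
  have h : ∀ φ a b, ρ.mat φ i a * M a j * ((M⁻¹ : GL (Fin m) ℂ) k b * ρ.mat φ⁻¹ b l) =
      (M⁻¹ : GL (Fin m) ℂ) k b * M a j * (ρ.mat φ i a * ρ.mat φ⁻¹ b l) := fun φ a b => by ring
  rw [Finset.sum_comm]
  have h1 : ∀ a, ∑ φ, ∑ b, ρ.mat φ i a * M a j * ((M⁻¹ : GL (Fin m) ℂ) k b * ρ.mat φ⁻¹ b l) =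
      (Fintype.card Φ / m : ℂ) * (if i = l then (M⁻¹ : GL (Fin m) ℂ) k a * M a j else 0) := by
    intro a
    rw [Finset.sum_comm, Finset.sum_eq_single a]
    · simp only [h]
      rw [← Finset.mul_sum, ρ.sum_mat_mul_mat]
      split_ifs <;> simp_all
      ring
    · intro b _ hb
      simp only [h]
      rw [← Finset.mul_sum, ρ.sum_mat_mul_mat, if_neg (fun h => hb h.2.symm), mul_zero, mul_zero]
    · simp
  simp only [h1]
  rw [← Finset.mul_sum]
  congr 1
  have h2 : ∑ a, (M⁻¹ : GL (Fin m) ℂ) k a * M a j = (1 : Matrix (Fin m) (Fin m) ℂ) k j := by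
    rw [← Matrix.mul_apply, ← Units.val_mul, inv_mul_cancel, Units.val_one]
  split_ifs with h3 h4 h4
  · rw [h2, h4.2, Matrix.one_apply_eq]
  · rw [h2, Matrix.one_apply_ne fun h => h4 ⟨h3, h.symm⟩]
  · exact absurd h4.1 h3
  · simp

namespace OrientedSurfaceComplex

variable {n : ℕ} {K : OrientedSurfaceComplex n}

lemma trace_mul_three {ι R : Type*} [Fintype ι] [CommRing R] (A B C : Matrix ι ι R) :
    (A * B * C).trace =
      ∑ j : Fin 3 → ι, ∏ k, ![A, B, C] k (j k) (j (k + 1)) := by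
  -- The order 0, 2, 1 is the one in which expanding `A * B * C` from the left-nested product
  -- introduces the summation indices.
  let e : (Fin 3 → ι) ≃ ι × ι × ι :=
    { toFun := fun j => (j 0, j 2, j 1)
      invFun := fun p => ![p.1, p.2.2, p.2.1]
      left_inv := fun j => by ext k; fin_cases k <;> rfl
      right_inv := fun p => rfl }
  rw [← Equiv.sum_comp e.symm, Fintype.sum_prod_type, Matrix.trace]
  refine Finset.sum_congr rfl fun i _ => ?_
  rw [Fintype.sum_prod_type, Matrix.diag_apply, Matrix.mul_apply]
  refine Finset.sum_congr rfl fun k _ => ?_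
  rw [Matrix.mul_apply, Finset.sum_mul]
  refine Finset.sum_congr rfl fun j _ => ?_
  rw [Fin.prod_univ_three]
  rfl

/-- The product of the traces over all triangles, as a sum over all labellings of the darts. -/
lemma prod_trace {ι R : Type*} [Fintype ι] [CommRing R] (B : K.Dart → Matrix ι ι R) :
    ∏ t : K.Triangle, (B t.1 * B t.1.rot * B t.1.rot.rot).trace =
      ∑ I : K.Dart → ι, ∏ d, B d (I d) (I d.rot) := by
  classical
  simp only [trace_mul_three]
  rw [Finset.prod_univ_sum, Fintype.piFinset_univ]
  refine Fintype.sum_equiv ((Equiv.curry _ _ _).symm.trans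
    (Equiv.arrowCongr cornerEquiv (Equiv.refl ι))) _ _ fun J => ?_
  rw [← Equiv.prod_comp cornerEquiv, Fintype.prod_prod_type]
  refine Finset.prod_congr rfl fun t _ => Finset.prod_congr rfl fun k _ => ?_
  have h1 : ∀ p : K.Triangle × Fin 3, cornerEquiv p = corner p := fun p => rfl
  have h2 : (cornerEquiv (t, k)).rot = cornerEquiv (t, k + 1) := rot_corner t k
  rw [h2]
  simp only [Equiv.trans_apply, Equiv.arrowCongr_apply, Function.comp_apply,
    Equiv.symm_apply_apply, Equiv.coe_refl, id]
  have h3 : B (cornerEquiv (t, k)) = ![B t.1, B t.1.rot, B t.1.rot.rot] k := by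
    fin_cases k <;> rfl
  rw [h3]
  rfl

/-- Since links are connected, such a labelling is a free choice of one label per vertex. This is
the origin of the factor m^n. -/
lemma card_invariant (K : OrientedSurfaceComplex n) (m : ℕ) [Fintype {I : K.Dart → Fin m //
    ∀ d, I d.flip.rot = I d}] :
    Fintype.card {I : K.Dart → Fin m // ∀ d, I d.flip.rot = I d} = m ^ n := by
  have h : Fintype.card (Fin n → Fin m) = m ^ n := by simp
  rw [← h]
  refine (Fintype.card_congr (Equiv.ofBijective
    (fun f : Fin n → Fin m => ⟨fun d : K.Dart => f d.src, fun d => rfl⟩) ⟨?_, ?_⟩)).symm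
  · intro f g h
    ext x
    obtain ⟨y, z, hx⟩ := K.cover x
    exact congrArg Fin.val (congrFun (congrArg Subtype.val h) ⟨_, hx⟩)
  · rintro ⟨I, hI⟩
    obtain ⟨f, hf⟩ := Dart.exists_eq_comp_src I hI
    exact ⟨f, Subtype.ext (funext fun d => (hf d).symm)⟩

/-- The state sum of an irreducible representation. -/
lemma sum_prod_trace {Φ : Type*} [Group Φ] [Fintype Φ] {m : ℕ} (ρ : IrrRep Φ m)
    (M : K.Edge → GL (Fin m) ℂ) (B : (K.Edge → Φ) → K.Dart → Matrix (Fin m) (Fin m) ℂ)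
    (hB : ∀ c e, B c e.1 = ρ.mat (c e) * (M e : Matrix (Fin m) (Fin m) ℂ))
    (hB' : ∀ c e, B c e.1.flip = ((M e)⁻¹ : GL (Fin m) ℂ) * ρ.mat (c e)⁻¹) :
    ∑ c, ∏ t : K.Triangle, (B c t.1 * B c t.1.rot * B c t.1.rot.rot).trace =
      (Fintype.card Φ / m : ℂ) ^ K.edgeCount * m ^ n := by
  classical
  simp only [prod_trace, prod_dart, hB, hB']
  rw [Finset.sum_comm]
  -- For fixed labels the sum over `c` factors over the edges. The two equalities forced at an edge
  -- are the invariance of `I` at its two darts.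
  have h1 : ∀ I : K.Dart → Fin m, ∑ c : K.Edge → Φ, ∏ e : K.Edge,
      (ρ.mat (c e) * (M e : Matrix (Fin m) (Fin m) ℂ)) (I e.1) (I e.1.rot) *
        (((M e)⁻¹ : GL (Fin m) ℂ) * ρ.mat (c e)⁻¹ : Matrix (Fin m) (Fin m) ℂ)
          (I e.1.flip) (I e.1.flip.rot) =
      (Fintype.card Φ / m : ℂ) ^ K.edgeCount *
        if ∀ d : K.Dart, I d.flip.rot = I d then 1 else 0 := by
    intro I
    have h2 := Finset.prod_univ_sum (fun _ : K.Edge => (Finset.univ : Finset Φ)) fun e φ =>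
      (ρ.mat φ * (M e : Matrix (Fin m) (Fin m) ℂ)) (I e.1) (I e.1.rot) *
        (((M e)⁻¹ : GL (Fin m) ℂ) * ρ.mat φ⁻¹ : Matrix (Fin m) (Fin m) ℂ)
          (I e.1.flip) (I e.1.flip.rot)
    rw [Fintype.piFinset_univ] at h2
    rw [← h2]
    simp only [IrrRep.sum_mat_mul_conj]
    rw [Finset.prod_mul_distrib, Finset.prod_const, Finset.card_univ, card_edge]
    congr 1
    split_ifs with h
    · refine Finset.prod_eq_one fun e _ => if_pos ⟨(h e.1).symm, ?_⟩
      have := h e.1.flip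
      rwa [Dart.flip_flip] at this
    · push Not at h
      obtain ⟨d, hd⟩ := h
      by_cases hlt : d.src < d.tgt
      · exact Finset.prod_eq_zero (Finset.mem_univ ⟨d, hlt⟩) (if_neg fun h => hd h.1.symm)
      · refine Finset.prod_eq_zero (Finset.mem_univ (nonEdgeEquiv ⟨d, hlt⟩))
          (if_neg fun h => hd ?_)
        have h' := h.2
        simp only [nonEdgeEquiv, Equiv.coe_fn_mk, Dart.flip_flip] at h'
        exact h'
  simp only [h1]
  rw [← Finset.mul_sum, Finset.sum_ite, Finset.sum_const_zero, add_zero, Finset.sum_const,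
    nsmul_one, ← Fintype.card_subtype, card_invariant]
  push_cast
  rfl

/-! ### Functions on edges and their twisted holonomy -/

section Cochains

variable {Φ π : Type*} [Group Φ] [Group π] [MulDistribMulAction π Φ] (G : K.Dart → π)

/-- The extension of a function on edges to all darts. -/
noncomputable def extend (c : K.Edge → Φ) (d : K.Dart) : Φ :=
  if h : d.src < d.tgt then c ⟨d, h⟩ else G d • (c (nonEdgeEquiv ⟨d, h⟩))⁻¹

lemma extend_edge (c : K.Edge → Φ) (e : K.Edge) : extend G c e.1 = c e := dif_pos e.2

variable {G} (hG : ∀ d, G d.flip = (G d)⁻¹)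

include hG in
lemma extend_flip (c : K.Edge → Φ) (d : K.Dart) :
    extend G c d.flip = (G d)⁻¹ • (extend G c d)⁻¹ := by
  by_cases h : d.src < d.tgt
  · have h' : ¬ d.flip.src < d.flip.tgt := not_lt.2 h.le
    rw [extend, dif_neg h', extend, dif_pos h, hG]
    simp [nonEdgeEquiv]
  · have h' : d.flip.src < d.flip.tgt := lt_of_le_of_ne (not_lt.1 h) d.src_ne_tgt.symm
    rw [extend, dif_pos h', extend, dif_neg h, ← smul_inv', inv_smul_smul]
    simp [nonEdgeEquiv]

variable (G) in
/-- The holonomy around a triangle, starting at the source of a dart. -/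
noncomputable def hol (c : K.Edge → Φ) (d : K.Dart) : Φ :=
  extend G c d * G d • extend G c d.rot * (G d * G d.rot) • extend G c d.rot.rot

/-- In the semidirect product the holonomy is the product of the three pairs (`extend G c d`, `G
d`). Starting one dart later conjugates this product by the first pair. -/
lemma hol_rot (hG₃ : ∀ d, G d * G d.rot * G d.rot.rot = 1) (c : K.Edge → Φ) (d : K.Dart) :
    G d • hol G c d.rot = (extend G c d)⁻¹ * hol G c d * extend G c d := by
  simp only [hol, smul_mul', smul_smul, Dart.rot_rot_rot, ← mul_assoc, hG₃, one_smul,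
    inv_mul_cancel, one_mul]

end Cochains

end OrientedSurfaceComplex

/-! ### Labellings of the triangles by irreducible representations -/

namespace IrrRep

variable {Φ π : Type*} [Group Φ] [Group π] [MulDistribMulAction π Φ] {n : ℕ}

/-- The representation `φ ↦ ρ (a φ)`. -/
def twist (ρ : IrrRep Φ n) (a : π) : IrrRep Φ n where
  hom := ρ.hom.comp (MulDistribMulAction.toMonoidHom Φ a)
  pos := ρ.pos
  irreducible V hV := ρ.irreducible V fun φ v hv => by
    have := hV (a⁻¹ • φ) v hv
    rwa [MonoidHom.comp_apply, MulDistribMulAction.toMonoidHom_apply, smul_inv_smul] at this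

lemma char_twist (ρ : IrrRep Φ n) (a : π) (φ : Φ) : (ρ.twist a).char φ = ρ.char (a • φ) := rfl

end IrrRep

namespace OrientedSurfaceComplex

variable {n : ℕ} {K : OrientedSurfaceComplex n}

/-- The triangle of a dart. -/
noncomputable def Dart.base (d : K.Dart) : K.Triangle := (cornerEquiv.symm d).1

lemma base_corner (t : K.Triangle) (k : Fin 3) : (corner (t, k)).base = t := by
  have : cornerEquiv.symm (cornerEquiv (t, k)) = (t, k) := cornerEquiv.symm_apply_apply _
  exact congrArg Prod.fst this

lemma Dart.exists_corner (d : K.Dart) : ∃ k, d = corner (d.base, k) :=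
  ⟨(cornerEquiv.symm d).2, (cornerEquiv.apply_symm_apply d).symm⟩

lemma base_triangle (t : K.Triangle) : t.1.base = t := base_corner t 0

@[simp]
lemma Dart.base_rot (d : K.Dart) : d.rot.base = d.base := by
  obtain ⟨k, hk⟩ := d.exists_corner
  generalize d.base = t at hk
  subst hk
  rw [rot_corner, base_corner]

lemma Dart.eq_of_base_eq {d d' : K.Dart} (h : d.base = d'.base) :
    d' = d ∨ d' = d.rot ∨ d' = d.rot.rot := by
  obtain ⟨k, hk⟩ := d.exists_corner
  obtain ⟨k', hk'⟩ := d'.exists_corner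
  rw [← h] at hk'
  generalize d.base = t at hk hk'
  subst hk hk'
  simp only [rot_corner]
  have : k' = k ∨ k' = k + 1 ∨ k' = k + 1 + 1 := by
    fin_cases k <;> fin_cases k' <;> decide
  rcases this with rfl | rfl | rfl <;> simp

lemma Dart.base_flip_ne (d : K.Dart) : d.flip.base ≠ d.base := by
  intro h
  rcases Dart.eq_of_base_eq h.symm with h | h | h
  · exact d.flip_ne h
  · exact d.flip_ne_rot h
  · exact d.flip_ne_rot_rot h

section

variable {Φ π : Type*} [Group Φ] [Group π] [MulDistribMulAction π Φ] (G : K.Dart → π)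

/-- The element which carries the source of a dart to the first vertex of its triangle. -/
noncomputable def Dart.frame (d : K.Dart) : π :=
  ![1, G d.base.1, G d.base.1 * G d.base.1.rot] (cornerEquiv.symm d).2

variable {G} (hG : ∀ d, G d.flip = (G d)⁻¹) (hG₃ : ∀ d, G d * G d.rot * G d.rot.rot = 1)

lemma frame_corner (t : K.Triangle) (k : Fin 3) :
    (corner (t, k)).frame G = ![1, G t.1, G t.1 * G t.1.rot] k := by
  have : cornerEquiv.symm (corner (t, k)) = (t, k) := cornerEquiv.symm_apply_apply (t, k)
  rw [Dart.frame, base_corner, this]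

lemma frame_triangle (t : K.Triangle) : t.1.frame G = 1 := frame_corner t 0

include hG₃ in
lemma Dart.frame_rot (d : K.Dart) : d.rot.frame G = d.frame G * G d := by
  obtain ⟨k, hk⟩ := d.exists_corner
  generalize d.base = t at hk
  subst hk
  rw [rot_corner, frame_corner, frame_corner]
  fin_cases k
  · exact (one_mul _).symm
  · rfl
  · exact (hG₃ t.1).symm

variable (G) in
/-- The character attached to a triangle, seen from the source of a dart. -/
noncomputable def dartChar (R : K.Triangle → Irr Φ) (d : K.Dart) (φ : Φ) : ℂ :=
  (R d.base).rep.char (d.frame G • φ)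

lemma dartChar_triangle (R : K.Triangle → Irr Φ) (t : K.Triangle) :
    dartChar G R t.1 = (R t).rep.char := by
  ext φ
  rw [dartChar, base_triangle, frame_triangle, one_smul]

include hG₃ in
lemma dartChar_rot (R : K.Triangle → Irr Φ) (d : K.Dart) (φ : Φ) :
    dartChar G R d.rot φ = dartChar G R d (G d • φ) := by
  rw [dartChar, dartChar, d.base_rot, d.frame_rot hG₃, mul_smul]

lemma dartChar_mul_comm (R : K.Triangle → Irr Φ) (d : K.Dart) (φ ψ : Φ) :
    dartChar G R d (φ * ψ) = dartChar G R d (ψ * φ) := by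
  rw [dartChar, dartChar, smul_mul', smul_mul', IrrRep.char_mul_comm]

include hG₃ in
lemma dartChar_hol_rot (R : K.Triangle → Irr Φ) (c : K.Edge → Φ) (d : K.Dart) :
    dartChar G R d.rot (hol G c d.rot) = dartChar G R d (hol G c d) := by
  rw [dartChar_rot hG₃, hol_rot hG₃, dartChar_mul_comm, mul_inv_cancel_left]

-- Rotation changes the holonomy by conjugation and by the action of `G d`; the character absorbs
-- the first and the frame the second. The factor of a triangle may therefore be computed at any of
-- its darts, in particular at those of a given edge.
include hG₃ in
lemma dartChar_hol (R : K.Triangle → Irr Φ) (c : K.Edge → Φ) (d : K.Dart) :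
    dartChar G R d (hol G c d) = (R d.base).rep.char (hol G c d.base.1) := by
  obtain ⟨k, hk⟩ := d.exists_corner
  generalize d.base = t at hk
  subst hk
  rw [← dartChar_triangle (G := G)]
  have h1 := dartChar_hol_rot hG₃ R c t.1
  have h2 := dartChar_hol_rot hG₃ R c t.1.rot
  fin_cases k
  · rfl
  · exact h1
  · exact h2.trans h1

open Classical in
/-- The function on edges with a given value at one edge, and trivial elsewhere. -/
noncomputable def single (e : K.Edge) (ψ : Φ) : K.Edge → Φ := fun e' => if e' = e then ψ else 1

lemma extend_single_mul {e : K.Edge} (ψ : Φ) (c : K.Edge → Φ) {d : K.Dart} (h : d ≠ e.1)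
    (h' : d ≠ e.1.flip) : extend G (single e ψ * c) d = extend G c d := by
  unfold extend
  split_ifs with hlt
  · rw [Pi.mul_apply, single, if_neg, one_mul]
    rintro rfl
    exact h rfl
  · rw [Pi.mul_apply, single, if_neg, one_mul]
    intro he
    refine h' ?_
    rw [← he]
    simp [nonEdgeEquiv]

lemma hol_single_mul_edge (e : K.Edge) (ψ : Φ) (c : K.Edge → Φ) :
    hol G (single e ψ * c) e.1 = ψ * hol G c e.1 := by
  rw [hol, hol, extend_edge, extend_edge,
    extend_single_mul ψ c e.1.rot_ne e.1.flip_ne_rot.symm,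
    extend_single_mul ψ c e.1.rot_rot_ne e.1.flip_ne_rot_rot.symm, Pi.mul_apply, single,
    if_pos rfl]
  simp only [mul_assoc]

include hG in
lemma hol_single_mul_flip (e : K.Edge) (ψ : Φ) (c : K.Edge → Φ) :
    hol G (single e ψ * c) e.1.flip = (G e.1)⁻¹ • ((extend G c e.1)⁻¹ * (ψ⁻¹ *
      G e.1 • ((extend G c e.1.flip)⁻¹ * hol G c e.1.flip))) := by
  have a1 : e.1.flip.rot ≠ e.1 :=
    fun h => e.1.flip.flip_ne_rot ((Dart.flip_flip e.1).trans h.symm)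
  have a2 : e.1.flip.rot.rot ≠ e.1 :=
    fun h => e.1.flip.flip_ne_rot_rot ((Dart.flip_flip e.1).trans h.symm)
  rw [hol, hol, extend_single_mul ψ c a1 e.1.flip.rot_ne,
    extend_single_mul ψ c a2 e.1.flip.rot_rot_ne, extend_flip hG (single e ψ * c),
    extend_edge, Pi.mul_apply, single, if_pos rfl, extend_edge]
  simp only [smul_mul', smul_inv', inv_smul_smul, mul_inv_rev, mul_assoc, inv_mul_cancel_left]

lemma hol_single_mul_of_ne (e : K.Edge) (ψ : Φ) (c : K.Edge → Φ) {t : K.Triangle}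
    (h : t ≠ e.1.base) (h' : t ≠ e.1.flip.base) :
    hol G (single e ψ * c) t.1 = hol G c t.1 := by
  have key : ∀ d : K.Dart, d.base = t → extend G (single e ψ * c) d = extend G c d := by
    intro d hd
    refine extend_single_mul ψ c ?_ ?_
    · rintro rfl
      exact h hd.symm
    · rintro rfl
      exact h' hd.symm
  rw [hol, hol, key t.1 (base_triangle t), key t.1.rot (by rw [Dart.base_rot, base_triangle]),
    key t.1.rot.rot (by rw [Dart.base_rot, Dart.base_rot, base_triangle])]

-- Only the two triangles at `e` see `ψ`, one through `ψ` and the other, by conjugation invariance,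
-- through `ψ⁻¹` in leading position: the shape required by `sum_char_mul_char`.
include hG hG₃ in
lemma prod_char_hol_single_mul (R : K.Triangle → Irr Φ) (e : K.Edge) (ψ : Φ)
    (c : K.Edge → Φ) :
    ∏ t : K.Triangle, (R t).rep.char (hol G (single e ψ * c) t.1) =
      (dartChar G R e.1 (ψ * hol G c e.1) * dartChar G R e.1.flip ((G e.1)⁻¹ • (ψ⁻¹ *
        (G e.1 • ((extend G c e.1.flip)⁻¹ * hol G c e.1.flip) * (extend G c e.1)⁻¹)))) *
      ∏ t ∈ (Finset.univ.erase e.1.base).erase e.1.flip.base, (R t).rep.char (hol G c t.1) := by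
  have h1 : (R e.1.base).rep.char (hol G (single e ψ * c) e.1.base.1) =
      dartChar G R e.1 (ψ * hol G c e.1) := by
    rw [← dartChar_hol hG₃, hol_single_mul_edge]
  have h2 : (R e.1.flip.base).rep.char (hol G (single e ψ * c) e.1.flip.base.1) =
      dartChar G R e.1.flip ((G e.1)⁻¹ • (ψ⁻¹ *
        (G e.1 • ((extend G c e.1.flip)⁻¹ * hol G c e.1.flip) * (extend G c e.1)⁻¹))) := by
    rw [← dartChar_hol hG₃, hol_single_mul_flip hG, smul_mul', dartChar_mul_comm, ← smul_mul',
      mul_assoc]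
  have h3 : ∏ t ∈ (Finset.univ.erase e.1.base).erase e.1.flip.base,
      (R t).rep.char (hol G (single e ψ * c) t.1) =
      ∏ t ∈ (Finset.univ.erase e.1.base).erase e.1.flip.base, (R t).rep.char (hol G c t.1) := by
    refine Finset.prod_congr rfl fun t ht => ?_
    rw [hol_single_mul_of_ne e ψ c (Finset.mem_erase.1 (Finset.mem_erase.1 ht).2).1
      (Finset.mem_erase.1 ht).1]
  have h4 : ∀ f : K.Triangle → ℂ, ∏ t, f t = f e.1.base * f e.1.flip.base *
      ∏ t ∈ (Finset.univ.erase e.1.base).erase e.1.flip.base, f t := fun f => by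
    rw [mul_assoc, Finset.mul_prod_erase _ f
      (Finset.mem_erase.2 ⟨e.1.base_flip_ne, Finset.mem_univ e.1.flip.base⟩),
      Finset.mul_prod_erase _ f (Finset.mem_univ e.1.base)]
  rw [← h1, ← h2, ← h3]
  exact h4 _

include hG hG₃ in
/-- If the characters attached to the triangles do not fit together along an edge, then their
contribution to the state sum vanishes. -/
lemma dartChar_flip_of_sum_ne_zero [Fintype Φ] (R : K.Triangle → Irr Φ)
    (hne : ∑ c, ∏ t : K.Triangle, (R t).rep.char (hol G c t.1) ≠ 0) (e : K.Edge) (φ : Φ) :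
    dartChar G R e.1 φ = dartChar G R e.1.flip ((G e.1)⁻¹ • φ) := by
  -- Both characters are transported to the source of `e`, where they belong to twisted irreducible
  -- representations.
  let ρ := (R e.1.base).rep.twist (e.1.frame G)
  let ρ' := (R e.1.flip.base).rep.twist (e.1.flip.frame G * (G e.1)⁻¹)
  have hρ : ∀ φ, dartChar G R e.1 φ = ρ.char φ := fun φ => rfl
  have hρ' : ∀ φ, dartChar G R e.1.flip ((G e.1)⁻¹ • φ) = ρ'.char φ := fun φ => by
    rw [IrrRep.char_twist, mul_smul, dartChar]
  rw [hρ, hρ']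
  refine ρ.char_eq_of_toIrr_eq ρ' (by_contra fun hne' => hne ?_) φ
  -- Multiplying `c` at `e` by `ψ` permutes the summands. Summing this over `ψ` gives |Φ| times the
  -- original sum.
  have h1 : ∀ ψ : Φ, ∑ c, ∏ t : K.Triangle, (R t).rep.char (hol G c t.1) =
      ∑ c, ∏ t : K.Triangle, (R t).rep.char (hol G (single e ψ * c) t.1) := fun ψ =>
    (Equiv.sum_comp (Equiv.mulLeft (single e ψ))
      fun c => ∏ t : K.Triangle, (R t).rep.char (hol G c t.1)).symm
  have h2 : ∑ _ψ : Φ, ∑ c, ∏ t : K.Triangle, (R t).rep.char (hol G c t.1) = 0 := by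
    rw [Finset.sum_congr rfl fun ψ _ => h1 ψ, Finset.sum_comm]
    refine Finset.sum_eq_zero fun c _ => ?_
    simp only [prod_char_hol_single_mul hG hG₃, hρ, hρ']
    rw [← Finset.sum_mul, ρ.sum_char_mul_char ρ' hne', zero_mul]
  rw [Finset.sum_const, nsmul_eq_mul, Finset.card_univ] at h2
  exact (mul_eq_zero.1 h2).resolve_left (Nat.cast_ne_zero.2 Fintype.card_ne_zero)

include hG hG₃ in
/-- In a family of characters with a non-zero contribution to the state sum, the characters are
defined by functions attached to the vertices. -/
lemma exists_vertex_function [Fintype Φ] (R : K.Triangle → Irr Φ)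
    (hne : ∑ c, ∏ t : K.Triangle, (R t).rep.char (hol G c t.1) ≠ 0) :
    ∃ f : Fin n → Φ → ℂ, (∀ t : K.Triangle, f t.1.src = (R t).rep.char) ∧
      ∀ (d : K.Dart) φ, f d.tgt φ = f d.src (G d • φ) := by
  have hflip : ∀ d φ, dartChar G R d.flip φ = dartChar G R d (G d • φ) := by
    intro d φ
    by_cases h : d.src < d.tgt
    · rw [dartChar_flip_of_sum_ne_zero hG hG₃ R hne ⟨d, h⟩, inv_smul_smul]
    · have h' : d.flip.src < d.flip.tgt := lt_of_le_of_ne (not_lt.1 h) d.src_ne_tgt.symm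
      have := dartChar_flip_of_sum_ne_zero hG hG₃ R hne ⟨d.flip, h'⟩ φ
      simpa [hG] using this
  -- Crossing the edge acts by `G d`, and the rotation that follows acts by `(G d)⁻¹`; the two
  -- cancel in a turn about the source.
  obtain ⟨f, hf⟩ := Dart.exists_eq_comp_src (dartChar G R) fun d => funext fun φ => by
    rw [dartChar_rot hG₃, hflip, hG, smul_inv_smul]
  refine ⟨f, fun t => ?_, fun d φ => ?_⟩
  · rw [← hf, dartChar_triangle]
  · rw [← hf, ← dartChar_rot hG₃, hf, Dart.src_rot]

end

end OrientedSurfaceComplex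

/-! ### The class ζ_ρ on the fundamental class, and the state sum of an invariant representation -/

lemma H2Cx.exists_pullback_mk {G H : Type} [Group G] [Group H] (g : G →* H)
    (f : groupCohomology.cocycles₂ (Rep.trivial ℤ H (Additive ℂˣ))) :
    ∃ f' : groupCohomology.cocycles₂ (Rep.trivial ℤ G (Additive ℂˣ)),
      H2Cx.pullback g (groupCohomology.H2π _ f) = groupCohomology.H2π _ f' ∧
        f'.1 = fun p => f.1 (g p.1, g p.2) := by
  refine ⟨groupCohomology.mapCocycles₂ (A := Rep.trivial ℤ H (Additive ℂˣ))
    (B := Rep.trivial ℤ G (Additive ℂˣ)) g (Rep.ofHom ⟨LinearMap.id, fun _ => rfl⟩) f, ?_, rfl⟩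
  exact congrArg (fun F => (ConcreteCategory.hom F) f)
    (groupCohomology.H2π_comp_map (A := Rep.trivial ℤ H (Additive ℂˣ))
      (B := Rep.trivial ℤ G (Additive ℂˣ)) g (Rep.ofHom ⟨LinearMap.id, fun _ => rfl⟩))

namespace ClosedOrientedSurface

variable {W : Type} [TopologicalSpace W] (S : ClosedOrientedSurface W) (w : W)

/-- Increasing triples that do not span a triangle have sign 0, and the others are the sorted
vertices of a unique `Triangle`. -/
lemma chainPairing_fundamentalChain
    (f : FundamentalGroup W w × FundamentalGroup W w → Additive ℂˣ) :
    chainPairing f (S.fundamentalChain w) = ∑ t : S.complex.Triangle,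
      S.complex.sign t.sorted.1 t.sorted.2.1 t.sorted.2.2 •
        f (S.edgeLoop w t.sorted.1 t.sorted.2.1, S.edgeLoop w t.sorted.2.1 t.sorted.2.2) := by
  classical
  let F : Fin S.n × Fin S.n × Fin S.n → Additive ℂˣ := fun p =>
    if p.1 < p.2.1 ∧ p.2.1 < p.2.2 then S.complex.sign p.1 p.2.1 p.2.2 •
      f (S.edgeLoop w p.1 p.2.1, S.edgeLoop w p.2.1 p.2.2) else 0
  have h1 : chainPairing f (S.fundamentalChain w) = ∑ p, F p := by
    rw [chainPairing, fundamentalChain]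
    simp only [map_sum, Fintype.sum_prod_type]
    refine Finset.sum_congr rfl fun x _ => Finset.sum_congr rfl fun y _ =>
      Finset.sum_congr rfl fun z _ => ?_
    simp only [F]
    split_ifs
    · rw [Finsupp.linearCombination_single]
    · rw [map_zero]
  have h2 : ∀ t : S.complex.Triangle, S.complex.sign t.sorted.1 t.sorted.2.1 t.sorted.2.2 •
        f (S.edgeLoop w t.sorted.1 t.sorted.2.1, S.edgeLoop w t.sorted.2.1 t.sorted.2.2) =
      F t.sorted := fun t => (if_pos t.sorted_lt).symm
  rw [h1, Finset.sum_congr rfl fun t _ => h2 t]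
  symm
  refine Finset.sum_of_injOn OrientedSurfaceComplex.Triangle.sorted
    OrientedSurfaceComplex.Triangle.sorted_injective.injOn (fun _ _ => Finset.mem_univ _)
    (fun p _ hp => ?_) fun _ _ => rfl
  simp only [F]
  split_ifs with h
  · by_cases h' : p ∈ S.complex.tri ∨ (p.2.1, p.1, p.2.2) ∈ S.complex.tri
    · obtain ⟨t, ht⟩ := OrientedSurfaceComplex.Triangle.exists_sorted_eq h.1 h.2 h'
      exact absurd ⟨t, Finset.mem_univ _, ht⟩ hp
    · push Not at h'
      rw [OrientedSurfaceComplex.sign, if_neg h'.1, if_neg h'.2, zero_smul]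
  · rfl

lemma edgeLoop_self (x : Fin S.n) : S.edgeLoop w x x = 1 := (S.isFlat_edgeLoop w).self x

lemma edgeLoop_symm (x y : Fin S.n) : S.edgeLoop w y x = (S.edgeLoop w x y)⁻¹ := by
  by_cases h : S.complex.Near x y
  · obtain ⟨t, ht, hx, hy⟩ := h
    rw [eq_inv_iff_mul_eq_one, S.edgeLoop_mul w ht hy hx hy, edgeLoop_self]
  · rw [edgeLoop, dif_neg h, edgeLoop, dif_neg (mt S.near_symm h), inv_one]

/-- The loop of a dart. -/
noncomputable def dartLoop (d : S.complex.Dart) : FundamentalGroup W w :=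
  S.edgeLoop w d.src d.tgt

lemma dartLoop_flip (d : S.complex.Dart) : S.dartLoop w d.flip = (S.dartLoop w d)⁻¹ :=
  S.edgeLoop_symm w _ _

lemma dartLoop_mul (d : S.complex.Dart) :
    S.dartLoop w d * S.dartLoop w d.rot = S.edgeLoop w d.src d.opp :=
  S.edgeLoop_mul w d.mem (by simp) (by simp) (by simp)

lemma dartLoop_mul_mul (d : S.complex.Dart) :
    S.dartLoop w d * S.dartLoop w d.rot * S.dartLoop w d.rot.rot = 1 := by
  rw [dartLoop_mul, dartLoop, OrientedSurfaceComplex.Dart.src_rot,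
    OrientedSurfaceComplex.Dart.tgt_rot, OrientedSurfaceComplex.Dart.tgt_rot,
    OrientedSurfaceComplex.Dart.opp_rot, S.edgeLoop_symm w d.src, mul_inv_cancel]

variable {Φ : Type*} [Group Φ] [MulDistribMulAction (FundamentalGroup W w) Φ] {m : ℕ}

section Projective

variable {w} (ρ : IrrRep Φ m) (hρ : ρ.stab (FundamentalGroup W w) = ⊤)

/-- The matrix by which an element of the fundamental group acts. -/
noncomputable def conjMat (a : FundamentalGroup W w) : GL (Fin m) ℂ :=
  ρ.conj (⟨a, by simp [hρ]⟩ : ρ.stab (FundamentalGroup W w))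

lemma hom_smul (a : FundamentalGroup W w) (φ : Φ) :
    ρ.hom (a • φ) = conjMat ρ hρ a * ρ.hom φ * (conjMat ρ hρ a)⁻¹ := by
  have := ρ.conj_spec (⟨a, by simp [hρ]⟩ : ρ.stab (FundamentalGroup W w)) (a • φ)
  rw [inv_smul_smul] at this
  rw [this, conjMat]
  group

/-- The number `ζ_{a,b}` in the case of an invariant representation. -/
noncomputable def zetaUnit (a b : FundamentalGroup W w) : ℂˣ :=
  ρ.zeta (⟨a, by simp [hρ]⟩ : ρ.stab (FundamentalGroup W w)) ⟨b, by simp [hρ]⟩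

lemma zetaUnit_smul (a b : FundamentalGroup W w) :
    (zetaUnit ρ hρ a b : ℂ) • ((conjMat ρ hρ a * conjMat ρ hρ b : GL (Fin m) ℂ) :
      Matrix (Fin m) (Fin m) ℂ) = conjMat ρ hρ (a * b) :=
  ρ.zeta_spec _ _

/-- The contribution of a triangle to `ζ_ρ([W])`. -/
noncomputable def triangleZeta (t : S.complex.Triangle) : ℂˣ :=
  zetaUnit ρ hρ (S.edgeLoop w t.sorted.1 t.sorted.2.1)
    (S.edgeLoop w t.sorted.2.1 t.sorted.2.2) ^
      S.complex.sign t.sorted.1 t.sorted.2.1 t.sorted.2.2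

lemma zetaEval_fundamentalClass :
    ρ.zetaEval hρ (S.fundamentalClass w) = ∏ t, S.triangleZeta ρ hρ t := by
  rw [IrrRep.zetaEval, IrrRep.zetaClass]
  obtain ⟨f, hf, hf'⟩ := H2Cx.exists_pullback_mk ((MonoidHom.id (FundamentalGroup W w)).codRestrict
    (ρ.stab (FundamentalGroup W w)) fun a => by simp [hρ]) ⟨_, ρ.zeta_mem⟩
  rw [hf, fundamentalClass, H2Cx.eval_mk, hf', chainPairing_fundamentalChain]
  rfl

/-- A matrix for every dart, such that opposite darts have inverse matrices. -/
noncomputable def dartMat (d : S.complex.Dart) : GL (Fin m) ℂ :=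
  if d.src < d.tgt then conjMat ρ hρ (S.dartLoop w d)
  else (conjMat ρ hρ (S.dartLoop w d.flip))⁻¹

/-- The matrix chosen for a⁻¹ agrees with M_a⁻¹ only up to a scalar. Using the inverse on descending
darts leaves no scalars at the edges, so that ζ comes from the triangles alone. -/
lemma dartMat_flip (d : S.complex.Dart) :
    S.dartMat ρ hρ d.flip = (S.dartMat ρ hρ d)⁻¹ := by
  unfold dartMat
  by_cases h : d.src < d.tgt
  · have h' : ¬ d.flip.src < d.flip.tgt := not_lt.2 h.le
    rw [if_neg h', if_pos h, d.flip_flip]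
  · have h' : d.flip.src < d.flip.tgt := lt_of_le_of_ne (not_lt.1 h) d.src_ne_tgt.symm
    rw [if_pos h', if_neg h, inv_inv]

lemma hom_dartLoop_smul (d : S.complex.Dart) (φ : Φ) :
    ρ.hom (S.dartLoop w d • φ) = S.dartMat ρ hρ d * ρ.hom φ * (S.dartMat ρ hρ d)⁻¹ := by
  unfold dartMat
  split_ifs
  · exact hom_smul ρ hρ _ _
  · have := hom_smul ρ hρ (S.dartLoop w d.flip) (S.dartLoop w d • φ)
    rw [dartLoop_flip, inv_smul_smul] at this
    rw [this, dartLoop_flip]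
    group

/-- With vertices x < y < z this is ζ M_xy M_yz M_xz⁻¹ = 1 for a positive triangle, up to cyclic
order. For a negative one the boundary is traversed backwards, which inverts the scalar; the sign in
the exponent accounts for this. -/
lemma triangleZeta_smul (t : S.complex.Triangle) :
    (S.triangleZeta ρ hρ t : ℂ) • ((S.dartMat ρ hρ t.1 * S.dartMat ρ hρ t.1.rot *
      S.dartMat ρ hρ t.1.rot.rot : GL (Fin m) ℂ) : Matrix (Fin m) (Fin m) ℂ) = 1 := by
  obtain ⟨d, hd₁, hd₂⟩ := t
  have hz := d.tgt_ne_opp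
  have hrr : ∀ d : S.complex.Dart, ¬ d.src < d.tgt →
      S.dartMat ρ hρ d = (conjMat ρ hρ (S.edgeLoop w d.tgt d.src))⁻¹ := fun d h => if_neg h
  have hr : ∀ d : S.complex.Dart, d.src < d.tgt →
      S.dartMat ρ hρ d = conjMat ρ hρ (S.edgeLoop w d.src d.tgt) := fun d h => if_pos h
  have key : ∀ x y z, S.edgeLoop w x y * S.edgeLoop w y z = S.edgeLoop w x z →
      (zetaUnit ρ hρ (S.edgeLoop w x y) (S.edgeLoop w y z) : ℂ) •
        ((conjMat ρ hρ (S.edgeLoop w x y) * conjMat ρ hρ (S.edgeLoop w y z) : GL (Fin m) ℂ) :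
          Matrix (Fin m) (Fin m) ℂ) = conjMat ρ hρ (S.edgeLoop w x z) := fun x y z h => by
    rw [zetaUnit_smul, h]
  rw [triangleZeta, OrientedSurfaceComplex.Triangle.sorted]
  by_cases h : d.tgt < d.opp
  · rw [if_pos h]
    have hs : S.complex.sign d.src d.tgt d.opp = 1 := if_pos d.mem
    rw [hs, zpow_one, hr d hd₁, hr d.rot h, hrr d.rot.rot (not_lt.2 hd₂.le), Units.val_mul,
      ← smul_mul_assoc]
    change (zetaUnit ρ hρ (S.edgeLoop w d.src d.tgt) (S.edgeLoop w d.tgt d.opp)).val •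
      ((conjMat ρ hρ (S.edgeLoop w d.src d.tgt) *
      conjMat ρ hρ (S.edgeLoop w d.tgt d.opp) : GL (Fin m) ℂ) : Matrix (Fin m) (Fin m) ℂ) *
      (((conjMat ρ hρ (S.edgeLoop w d.src d.opp))⁻¹ : GL (Fin m) ℂ) :
        Matrix (Fin m) (Fin m) ℂ) = 1
    rw [key d.src d.tgt d.opp (S.dartLoop_mul w d), ← Units.val_mul, mul_inv_cancel, Units.val_one]
  · rw [if_neg h]
    have h' : d.opp < d.tgt := lt_of_le_of_ne (not_lt.1 h) hz.symm
    have hs : S.complex.sign d.src d.opp d.tgt = -1 := by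
      have h1 : S.complex.sign d.src d.tgt d.opp = 1 := if_pos d.mem
      have h2 := S.complex.sign_rotate d.src d.tgt d.opp
      have h3 := S.complex.sign_swap d.opp d.tgt d.src
      have h4 := S.complex.sign_rotate d.src d.opp d.tgt
      have h5 := S.complex.sign_rotate d.tgt d.opp d.src
      have h6 := S.complex.sign_rotate d.opp d.tgt d.src
      omega
    rw [hs, zpow_neg, zpow_one, hr d hd₁, hrr d.rot h, hrr d.rot.rot (not_lt.2 hd₂.le)]
    change ((zetaUnit ρ hρ (S.edgeLoop w d.src d.opp) (S.edgeLoop w d.opp d.tgt))⁻¹ : ℂˣ).val •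
      ((conjMat ρ hρ (S.edgeLoop w d.src d.tgt) *
      (conjMat ρ hρ (S.edgeLoop w d.opp d.tgt))⁻¹ *
      (conjMat ρ hρ (S.edgeLoop w d.src d.opp))⁻¹ : GL (Fin m) ℂ) : Matrix (Fin m) (Fin m) ℂ) = 1
    have := key d.src d.opp d.tgt (S.edgeLoop_mul w d.mem (by simp) (by simp) (by simp))
    rw [mul_assoc, ← mul_inv_rev, Units.val_mul, ← this, smul_mul_assoc, smul_smul,
      ← Units.val_mul, ← Units.val_mul, inv_mul_cancel, mul_inv_cancel]
    simp

/-- The state sum of an invariant representation. -/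
lemma sum_prod_char_hol [Fintype Φ] :
    ∑ c, ∏ t : S.complex.Triangle,
      ρ.char (OrientedSurfaceComplex.hol (S.dartLoop w) c t.1) =
      (ρ.zetaEval hρ (S.fundamentalClass w) : ℂ) *
        ((Fintype.card Φ / m : ℂ) ^ S.complex.edgeCount * m ^ S.n) := by
  let B : (S.complex.Edge → Φ) → S.complex.Dart → GL (Fin m) ℂ := fun c d =>
    ρ.hom (OrientedSurfaceComplex.extend (S.dartLoop w) c d) * S.dartMat ρ hρ d
  have h1 : ∀ c (t : S.complex.Triangle),
      ρ.char (OrientedSurfaceComplex.hol (S.dartLoop w) c t.1) =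
        S.triangleZeta ρ hρ t * ((B c t.1 : Matrix (Fin m) (Fin m) ℂ) * B c t.1.rot *
          B c t.1.rot.rot).trace := by
    intro c t
    let M := S.dartMat ρ hρ
    -- Since G d acts under ρ as conjugation by `M d`, the product telescopes, leaving at the end
    -- the inverse of the product of the three `M`, which is the scalar of the triangle.
    have h2 : ρ.hom (OrientedSurfaceComplex.hol (S.dartLoop w) c t.1) =
        B c t.1 * B c t.1.rot * B c t.1.rot.rot * (M t.1 * M t.1.rot * M t.1.rot.rot)⁻¹ := by
      rw [OrientedSurfaceComplex.hol, map_mul, map_mul, mul_smul, S.hom_dartLoop_smul ρ hρ,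
        S.hom_dartLoop_smul ρ hρ, S.hom_dartLoop_smul ρ hρ]
      simp only [B, M]
      group
    have h3 : (((M t.1 * M t.1.rot * M t.1.rot.rot)⁻¹ : GL (Fin m) ℂ) :
        Matrix (Fin m) (Fin m) ℂ) = (S.triangleZeta ρ hρ t : ℂ) • 1 := by
      have := congrArg (fun X : Matrix (Fin m) (Fin m) ℂ => X *
        (((M t.1 * M t.1.rot * M t.1.rot.rot)⁻¹ : GL (Fin m) ℂ) : Matrix (Fin m) (Fin m) ℂ))
        (S.triangleZeta_smul ρ hρ t)
      simp only [smul_mul_assoc, one_mul] at this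
      rw [← this, ← Units.val_mul, mul_inv_cancel, Units.val_one]
    rw [IrrRep.char, IrrRep.mat, h2, Units.val_mul, h3, Matrix.mul_smul, Matrix.mul_one,
      Matrix.trace_smul, smul_eq_mul, Units.val_mul, Units.val_mul]
  simp only [h1, Finset.prod_mul_distrib]
  rw [← Finset.mul_sum, OrientedSurfaceComplex.sum_prod_trace ρ
    (fun e => S.dartMat ρ hρ e.1) (fun c d => (B c d : Matrix (Fin m) (Fin m) ℂ)) ?_ ?_,
    zetaEval_fundamentalClass, Units.coe_prod]
  · intro c e
    simp only [B, OrientedSurfaceComplex.extend_edge]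
    rfl
  · intro c e
    have : B c e.1.flip = (S.dartMat ρ hρ e.1)⁻¹ * ρ.hom (c e)⁻¹ := by
      simp only [B]
      rw [OrientedSurfaceComplex.extend_flip (S.dartLoop_flip w), ← S.dartLoop_flip w,
        S.hom_dartLoop_smul ρ hρ, S.dartMat_flip, OrientedSurfaceComplex.extend_edge]
      group
    rw [this]
    rfl

end Projective

end ClosedOrientedSurface

/-! ### Counting twisted cocycles by characters -/

lemma Irr.exists_conj_of_char_smul_eq {Φ π : Type*} [Group Φ] [Finite Φ] [Group π]
    [MulDistribMulAction π Φ] (c : Irr Φ) (a : π)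
    (h : ∀ φ : Φ, c.rep.char (a • φ) = c.rep.char φ) :
    ∃ M : GL (Fin c.dim) ℂ, ∀ φ : Φ, c.rep.hom (a • φ) = M⁻¹ * c.rep.hom φ * M :=
  IrrRep.toIrr_eq_iff.1 (c.rep.toIrr_eq_of_char_eq (c.rep.twist a) fun φ => (h φ).symm)

/-- The cocycle condition on a triple follows from its cyclic form. -/
lemma mul_eq_of_cyclic {ι H : Type*} [Group H] (P : ι → ι → H) (h₁ : ∀ x, P x x = 1)
    (h₂ : ∀ x y, P y x = (P x y)⁻¹) {a b c : ι} (h : P a b * P b c * P c a = 1) {x y z : ι}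
    (hx : x = a ∨ x = b ∨ x = c) (hy : y = a ∨ y = b ∨ y = c) (hz : z = a ∨ z = b ∨ z = c) :
    P x y * P y z = P x z := by
  have hac : P a c = P a b * P b c := by
    rw [h₂ c a]
    exact (eq_inv_of_mul_eq_one_left h).symm
  have key : ∀ x, (x = a ∨ x = b ∨ x = c) → ∀ y, (y = a ∨ y = b ∨ y = c) →
      P x y = (P a x)⁻¹ * P a y := by
    intro x hx y hy
    rcases hx with hx | hx | hx <;> rcases hy with hy | hy | hy <;> rw [hx, hy]
    · simp [h₁]
    · simp [h₁]
    · simp [h₁]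
    · simp [h₁, h₂ a b]
    · simp [h₁]
    · simp [hac]
    · simp [h₁, h₂ a c]
    · simp [hac, h₂ b c]
    · simp [h₁]
  rw [key x hx y hy, key y hy z hz, key x hx z hz, mul_assoc, mul_inv_cancel_left]

namespace ClosedOrientedSurface

variable {W : Type} [TopologicalSpace W] (S : ClosedOrientedSurface W) (w : W)

/-- A family of functions on the vertices which is compatible with the edges is invariant. -/
lemma vertex_function_invariant {Φ β : Type*} [Group Φ]
    [MulDistribMulAction (FundamentalGroup W w) Φ] (f : Fin S.n → Φ → β)
    (hf : ∀ (d : S.complex.Dart) φ, f d.tgt φ = f d.src (S.dartLoop w d • φ)) (x y : Fin S.n)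
    (a : FundamentalGroup W w) (φ : Φ) : f x (a • φ) = f y φ := by
  have hnear : ∀ x y, S.complex.Near x y → ∀ φ, f x φ = f y (S.edgeLoop w y x • φ) := by
    rintro x y ⟨t, ht, hx, hy⟩ φ
    have h1 : ∀ d : S.complex.Dart, f d.tgt φ = f d.src (S.edgeLoop w d.src d.tgt • φ) :=
      fun d => hf d φ
    have h2 : ∀ d : S.complex.Dart, f d.src φ = f d.tgt (S.edgeLoop w d.tgt d.src • φ) :=
      fun d => hf d.flip φ
    have h0 : ∀ x, f x φ = f x (S.edgeLoop w x x • φ) := fun x => by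
      rw [edgeLoop_self, one_smul]
    let d : S.complex.Dart := ⟨t, ht⟩
    rcases hx with rfl | rfl | rfl <;> rcases hy with rfl | rfl | rfl
    · exact h0 _
    · exact h2 d
    · exact h1 d.rot.rot
    · exact h1 d
    · exact h0 _
    · exact h2 d.rot
    · exact h2 d.rot.rot
    · exact h1 d.rot
    · exact h0 _
  have key : ∀ x y (q : Path.Homotopic.Quotient (S.vertex x) (S.vertex y)),
      ∀ φ, f x φ = f y (S.loop w q • φ) := by
    refine S.edgePath_induction (fun x φ => ?_) fun x y z q h ih φ => ?_
    · rw [loop_refl, one_smul]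
    · rw [ih, hnear y z h, loop_trans, loop_edgePath, mul_smul]
  -- The path from `y` to `x` through the base point has trivial loop and moves the value to `x`;
  -- the loop `a⁻¹` at `x` then removes `a`.
  rw [key y x (S.joinClass w y x), key x x (S.vertexLoop w x a⁻¹), loop_vertexLoop, loop_joinClass,
    inv_smul_smul, one_smul]

variable {Φ : Type*} [Group Φ] [MulDistribMulAction (FundamentalGroup W w) Φ]

/-- The restriction of a twisted cocycle to the edges. -/
def restrictEdges (c : S.TwistedCocycle w Φ) : S.complex.Edge → Φ := fun e => c.1 e.1.src e.1.tgt

lemma restrictEdges_self (c : S.TwistedCocycle w Φ) (x : Fin S.n) : c.1 x x = 1 := by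
  obtain ⟨y, z, h⟩ := S.complex.cover x
  have := c.2.2 _ h x x x (by simp) (by simp) (by simp)
  rw [edgeLoop_self, one_smul] at this
  exact mul_eq_left.1 this

lemma extend_restrictEdges (c : S.TwistedCocycle w Φ) (d : S.complex.Dart) :
    OrientedSurfaceComplex.extend (S.dartLoop w) (S.restrictEdges w c) d = c.1 d.src d.tgt := by
  unfold OrientedSurfaceComplex.extend
  split_ifs
  · rfl
  · change S.edgeLoop w d.src d.tgt • (c.1 d.tgt d.src)⁻¹ = _
    have := c.2.2 _ d.mem d.src d.tgt d.src (by simp) (by simp) (by simp)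
    rw [restrictEdges_self] at this
    rw [smul_inv', inv_eq_of_mul_eq_one_left this]

lemma restrictEdges_injective : Function.Injective (S.restrictEdges w (Φ := Φ)) := by
  intro c c' h
  refine Subtype.ext (funext fun x => funext fun y => ?_)
  have key : ∀ d : S.complex.Dart, c.1 d.src d.tgt = c'.1 d.src d.tgt := fun d => by
    rw [← extend_restrictEdges, ← extend_restrictEdges, h]
  by_cases hn : S.complex.Near x y
  · obtain ⟨t, ht, hx, hy⟩ := hn
    let d : S.complex.Dart := ⟨t, ht⟩
    rcases hx with rfl | rfl | rfl <;> rcases hy with rfl | rfl | rfl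
    · rw [restrictEdges_self, restrictEdges_self]
    · exact key d
    · exact key d.rot.rot.flip
    · exact key d.flip
    · rw [restrictEdges_self, restrictEdges_self]
    · exact key d.rot
    · exact key d.rot.rot
    · exact key d.rot.flip
    · rw [restrictEdges_self, restrictEdges_self]
  · rw [c.2.1 x y hn, c'.2.1 x y hn]

lemma hol_restrictEdges (c : S.TwistedCocycle w Φ) (d : S.complex.Dart) :
    OrientedSurfaceComplex.hol (S.dartLoop w) (S.restrictEdges w c) d = 1 := by
  have h1 := c.2.2 _ d.mem d.src d.tgt d.opp (by simp) (by simp) (by simp)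
  have h2 := c.2.2 _ d.mem d.src d.opp d.src (by simp) (by simp) (by simp)
  rw [restrictEdges_self] at h2
  rw [OrientedSurfaceComplex.hol, extend_restrictEdges, extend_restrictEdges,
    extend_restrictEdges, dartLoop_mul]
  exact (congrArg (· * _) h1).trans h2

-- In Φ ⋊ π, trivial holonomy is the cyclic relation P_ab P_bc P_ca = 1, first at one dart of each
-- triangle and by `hol_rot` at all. With P_yx = P_xy⁻¹ it gives the cocycle condition for every
-- triple, including degenerate ones.
open Classical in
lemma exists_restrictEdges_eq (c : S.complex.Edge → Φ)
    (hc : ∀ t : S.complex.Triangle, OrientedSurfaceComplex.hol (S.dartLoop w) c t.1 = 1) :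
    ∃ c' : S.TwistedCocycle w Φ, S.restrictEdges w c' = c := by
  let f : Fin S.n → Fin S.n → Φ := fun x y =>
    if h : ∃ d : S.complex.Dart, d.src = x ∧ d.tgt = y then
      OrientedSurfaceComplex.extend (S.dartLoop w) c h.choose else 1
  have hf : ∀ d : S.complex.Dart,
      f d.src d.tgt = OrientedSurfaceComplex.extend (S.dartLoop w) c d := by
    intro d
    have h : ∃ d' : S.complex.Dart, d'.src = d.src ∧ d'.tgt = d.tgt := ⟨d, rfl, rfl⟩
    simp only [f]
    rw [dif_pos h, OrientedSurfaceComplex.Dart.ext_src_tgt h.choose_spec.1 h.choose_spec.2]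
  have hf' : ∀ x y, (¬ ∃ d : S.complex.Dart, d.src = x ∧ d.tgt = y) → f x y = 1 :=
    fun x y h => dif_neg h
  let P : Fin S.n → Fin S.n →
      Φ ⋊[MulDistribMulAction.toMulAut (FundamentalGroup W w) Φ] FundamentalGroup W w :=
    fun x y => ⟨f x y, S.edgeLoop w x y⟩
  have hP₁ : ∀ x, P x x = 1 := fun x =>
    SemidirectProduct.ext (hf' x x fun ⟨d, h, h'⟩ => d.src_ne_tgt (h.trans h'.symm))
      (S.edgeLoop_self w x)
  have hP₂ : ∀ x y, P y x = (P x y)⁻¹ := by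
    intro x y
    refine SemidirectProduct.ext ?_ (S.edgeLoop_symm w x y)
    change f y x = (S.edgeLoop w x y)⁻¹ • (f x y)⁻¹
    by_cases h : ∃ d : S.complex.Dart, d.src = x ∧ d.tgt = y
    · obtain ⟨d, rfl, rfl⟩ := h
      rw [hf d]
      exact (hf d.flip).trans (OrientedSurfaceComplex.extend_flip (S.dartLoop_flip w) c d)
    · have h' : ¬ ∃ d : S.complex.Dart, d.src = y ∧ d.tgt = x :=
        fun ⟨d, hy, hx⟩ => h ⟨d.flip, hx, hy⟩
      rw [hf' _ _ h, hf' _ _ h', inv_one, smul_one]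
  have hhol : ∀ d : S.complex.Dart, OrientedSurfaceComplex.hol (S.dartLoop w) c d = 1 := by
    have hrot : ∀ d : S.complex.Dart, OrientedSurfaceComplex.hol (S.dartLoop w) c d = 1 →
        OrientedSurfaceComplex.hol (S.dartLoop w) c d.rot = 1 := by
      intro d hd
      have := OrientedSurfaceComplex.hol_rot (S.dartLoop_mul_mul w) c d
      rw [hd, mul_one, inv_mul_cancel] at this
      rw [← inv_smul_smul (S.dartLoop w d)
        (OrientedSurfaceComplex.hol (S.dartLoop w) c d.rot), this, smul_one]
    intro d
    obtain ⟨k, hk⟩ := d.exists_corner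
    rw [hk]
    fin_cases k
    · exact hc _
    · exact hrot _ (hc _)
    · exact hrot _ (hrot _ (hc _))
  have hP₃ : ∀ d : S.complex.Dart, P d.src d.tgt * P d.tgt d.opp * P d.opp d.src = 1 := by
    intro d
    refine SemidirectProduct.ext ?_ (S.dartLoop_mul_mul w d)
    refine Eq.trans ?_ (hhol d)
    rw [OrientedSurfaceComplex.hol, ← hf, ← hf, ← hf]
    rfl
  refine ⟨⟨f, fun x y h => hf' x y ?_, fun t ht x y z hx hy hz => ?_⟩, funext fun e => ?_⟩
  · rintro ⟨d, rfl, rfl⟩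
    exact h ⟨_, d.mem, by simp, by simp⟩
  · exact congrArg SemidirectProduct.left (mul_eq_of_cyclic P hP₁ hP₂ (hP₃ ⟨t, ht⟩) hx hy hz)
  · exact (hf e.1).trans (OrientedSurfaceComplex.extend_edge _ c e)

lemma card_twistedCocycle_eq [Fintype Φ] [DecidableEq Φ] :
    Nat.card (S.TwistedCocycle w Φ) = ∑ c : S.complex.Edge → Φ, ∏ t : S.complex.Triangle,
      if OrientedSurfaceComplex.hol (S.dartLoop w) c t.1 = 1 then 1 else 0 := by
  have h1 : ∀ c : S.complex.Edge → Φ, (∏ t : S.complex.Triangle,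
      if OrientedSurfaceComplex.hol (S.dartLoop w) c t.1 = 1 then 1 else 0) =
      if ∀ t : S.complex.Triangle, OrientedSurfaceComplex.hol (S.dartLoop w) c t.1 = 1
        then 1 else 0 := fun c => by
    rw [Finset.prod_ite_zero]
    simp
  simp only [h1]
  rw [← Finset.card_filter, ← Fintype.card_subtype, ← Nat.card_eq_fintype_card]
  exact Nat.card_congr (Equiv.ofBijective (fun c => ⟨S.restrictEdges w c, fun t =>
    S.hol_restrictEdges w c t.1⟩) ⟨fun c c' h => S.restrictEdges_injective w
      (congrArg Subtype.val h), fun ⟨c, hc⟩ => by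
        obtain ⟨c', hc'⟩ := S.exists_restrictEdges_eq w c hc
        exact ⟨c', Subtype.ext hc'⟩⟩)

/-- The number of twisted cocycles, as a sum over the invariant irreducible representations. -/
lemma card_twistedCocycle_eq_sum [Fintype Φ] [Fintype (Irr Φ)]
    [Fintype {c : Irr Φ // c.rep.stab (FundamentalGroup W w) = ⊤}] :
    (Nat.card (S.TwistedCocycle w Φ) : ℂ) =
      ∑ c : {c : Irr Φ // c.rep.stab (FundamentalGroup W w) = ⊤},
        (c.1.dim / Fintype.card Φ : ℂ) ^ S.complex.triangleCount *
          ((c.1.rep.zetaEval c.2 (S.fundamentalClass w) : ℂ) *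
            ((Fintype.card Φ / c.1.dim : ℂ) ^ S.complex.edgeCount * c.1.dim ^ S.n)) := by
  classical
  have hΦ : (Fintype.card Φ : ℂ) ≠ 0 := Nat.cast_ne_zero.2 Fintype.card_ne_zero
  have hδ : ∀ φ : Φ, ((if φ = 1 then 1 else 0 : ℕ) : ℂ) =
      ∑ c : Irr Φ, c.dim / Fintype.card Φ * c.rep.char φ := by
    intro φ
    have h := sum_dim_mul_char φ
    have h1 : ∀ c : Irr Φ, (c.dim : ℂ) / Fintype.card Φ * c.rep.char φ =
        (c.dim * c.rep.char φ) / Fintype.card Φ := fun c => by ring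
    simp only [h1]
    rw [← Finset.sum_div, h]
    split_ifs <;> simp [hΦ]
  -- A product over triangles of sums over `Irr Φ` is a sum over labellings `R` of the triangles.
  have h1 : (Nat.card (S.TwistedCocycle w Φ) : ℂ) = ∑ R : S.complex.Triangle → Irr Φ,
      (∏ t, ((R t).dim / Fintype.card Φ : ℂ)) * ∑ c, ∏ t : S.complex.Triangle,
        (R t).rep.char (OrientedSurfaceComplex.hol (S.dartLoop w) c t.1) := by
    rw [card_twistedCocycle_eq, Nat.cast_sum]
    simp only [Nat.cast_prod, hδ, Finset.prod_univ_sum, Fintype.piFinset_univ,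
      Finset.prod_mul_distrib]
    rw [Finset.sum_comm]
    simp only [Finset.mul_sum]
  rw [h1]
  symm
  obtain ⟨t₀⟩ : Nonempty S.complex.Triangle := by
    obtain ⟨t, ht⟩ := S.complex.nonempty
    exact ⟨OrientedSurfaceComplex.Dart.base (K := S.complex) ⟨t, ht⟩⟩
  -- Invariant representations are embedded as constant labellings; every labelling outside the
  -- image contributes zero.
  refine Finset.sum_of_injOn (fun c _ => c.1)
    (fun c _ c' _ h => Subtype.ext (congrFun h t₀)) (fun _ _ => Finset.mem_univ _)
    (fun R _ hR => ?_) fun c _ => ?_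
  · by_contra hne
    obtain ⟨f, hf, hf'⟩ := OrientedSurfaceComplex.exists_vertex_function (S.dartLoop_flip w)
      (S.dartLoop_mul_mul w) R (right_ne_zero_of_mul hne)
    have hinv : ∀ t t' (a : FundamentalGroup W w) φ,
        (R t).rep.char (a • φ) = (R t').rep.char φ := fun t t' a φ => by
      rw [← hf, ← hf]
      exact S.vertex_function_invariant w f hf' _ _ a φ
    have hconst : ∀ t, R t = R t₀ := fun t => Irr.eq_of_char_eq _ _ fun φ => by
      have := hinv t t₀ 1 φ
      rwa [one_smul] at this
    refine hR ⟨⟨R t₀, eq_top_iff.2 fun a _ => ?_⟩, Finset.mem_coe.2 (Finset.mem_univ _),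
      funext fun t => (hconst t).symm⟩
    -- `stab` is defined by the action of `a⁻¹`.
    exact (R t₀).exists_conj_of_char_smul_eq a⁻¹ fun φ => hinv t₀ t₀ _ φ
  · simp only
    rw [S.sum_prod_char_hol c.1.rep c.2, Finset.prod_const, Finset.card_univ,
      OrientedSurfaceComplex.card_triangle]

end ClosedOrientedSurface

theorem theorem8p4p1 {W : Type} [TopologicalSpace W] (S : ClosedOrientedSurface W)
    (hS : 0 < S.genus) (w : W) {Φ : Type*} [Group Φ] [Finite Φ]
    [MulDistribMulAction (FundamentalGroup W w) Φ] :
    Finite (NonabH1 (FundamentalGroup W w) Φ) ∧ Finite (Irr Φ) ∧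
    ((nonabMeasure (FundamentalGroup W w) Φ : ℚ) : ℂ) =
      ∑ᶠ c : {c : Irr Φ // c.rep.stab (FundamentalGroup W w) = ⊤},
        ((Nat.card Φ : ℂ) / (c.1.dim : ℂ)) ^ (-S.eulerChar) *
          (c.1.rep.zetaEval c.2 (S.fundamentalClass w) : ℂ) := by
  have := S.finite_nonabCocycle w (Φ := Φ)
  refine ⟨Quotient.finite _, inferInstance, ?_⟩
  have := Fintype.ofFinite Φ
  have := Fintype.ofFinite (Irr Φ)
  have := Fintype.ofFinite {c : Irr Φ // c.rep.stab (FundamentalGroup W w) = ⊤}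
  have hΦ : (Fintype.card Φ : ℂ) ≠ 0 := Nat.cast_ne_zero.2 Fintype.card_ne_zero
  have h1 : (Nat.card (NonabCocycle (FundamentalGroup W w) Φ) : ℂ) * Fintype.card Φ ^ S.n =
      Nat.card (S.TwistedCocycle w Φ) * Fintype.card Φ := by
    rw [← Nat.card_eq_fintype_card]
    exact_mod_cast S.card_twistedCocycle w
  have h2 : (Nat.card (NonabCocycle (FundamentalGroup W w) Φ) : ℂ) / Fintype.card Φ =
      Nat.card (S.TwistedCocycle w Φ) / Fintype.card Φ ^ S.n := by
    rw [div_eq_div_iff hΦ (pow_ne_zero _ hΦ), h1]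
  rw [nonabMeasure_eq, finsum_eq_sum_of_fintype, Nat.card_eq_fintype_card (α := Φ)]
  push_cast
  rw [h2, S.card_twistedCocycle_eq_sum w, Finset.sum_div]
  refine Finset.sum_congr rfl fun c _ => ?_
  have hd : (c.1.dim : ℂ) ≠ 0 := Nat.cast_ne_zero.2 c.1.rep.pos.ne'
  -- The exponent of |Φ|/dim collects E from the edges, -F from the Fourier coefficients, and -n
  -- from dim^n at the vertices over the gauge factor |Φ|^n.
  have hχ : -S.eulerChar = (S.complex.edgeCount : ℤ) - S.n - S.complex.triangleCount := by
    rw [ClosedOrientedSurface.eulerChar, OrientedSurfaceComplex.eulerChar]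
    ring
  rw [hχ, zpow_sub₀ (div_ne_zero hΦ hd), zpow_sub₀ (div_ne_zero hΦ hd), zpow_natCast,
    zpow_natCast, zpow_natCast]
  simp only [div_pow]
  field_simp
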